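/- Let $d\ge 1$ and let $Z(t)$, $t\in\mathbb{R}^d$, be a non-negative random field on a probability space $(\Omega,\mathcal F,\mathbb P)$ such that $\mathbb{E}[Z(t)]=1$ for all $t\in\mathbb{R}^d$ and $\mathbb{E}\big[\sup_{t\in[0,T]^d}Z(t)\big]<\infty$ for all $T>0$. Suppose that $Z$ is a spectral random field of a stationary max-stable random field, that is, the random field $$X(t)=\max_{i\ge 1}\Gamma_i^{-1}Z^{(i)}(t),\qquad t\in\mathbb{R}^d,$$ is stationary (its finite-dimensional distributions are invariant under shifts of $\mathbb{R}^d$), where $\Gamma_i=\mathcal V_1+\dots+\mathcal V_i$ with $\mathcal V_1,\mathcal V_2,\dots$ independent unit exponential random variables, independent of the independent copies $Z^{(1)},Z^{(2)},\dots$ of $Z$. For $x\ge 0$ let $$\mathcal{B}_Z^0(x)=\lim_{T\to\infty}\frac1{T^d}\int_0^\infty \mathbb{P}\Big\{\int_{[0,T]^d}\mathbb{I}(Z(t)>s)\,dt>x\Big\}\,ds .$$ If $Z$ has almost surely continuous trajectories, then this limit exists and is finite for every $x\ge 0$, and $x\mapsto \mathcal{B}_Z^0(x)$ is continuous on $[0,\infty)$,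 i.e. $\lim_{x\to x_0}\mathcal{B}_Z^0(x)=\mathcal{B}_Z^0(x_0)$ for all $x_0\ge 0$ (with $x\to x_0$ within $[0,\infty)$). -/

import Mathlib

open MeasureTheory ProbabilityTheory Filter Topology
open scoped ENNReal

noncomputable section

namespace Berman

variable {Ω : Type*} {d : ℕ}

/-- The probability space carrying the points `Γ_i` and the independent copies `Z^{(i)}`:
a sample is a pair `(v, ω)` where `v k` are i.i.d. unit exponential, `ω i` are i.i.d. with law `P`,
and the two sequences are independent. -/
def deHaanMeasure [MeasurableSpace Ω] (P : Measure Ω) [IsProbabilityMeasure P] :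
    Measure ((ℕ → ℝ) × (ℕ → Ω)) :=
  (Measure.infinitePi (fun _ : ℕ => expMeasure 1)).prod (Measure.infinitePi (fun _ : ℕ => P))

/-- The arrival times `Γ_i` (indexed from `i = 0`): partial sums of the exponential variables. -/
def arrival (i : ℕ) (v : ℕ → ℝ) : ℝ := ∑ k ∈ Finset.range (i + 1), v k

/-- The max-stable random field with spectral random field `Z`:
`X(t) = sup_i Γ_i⁻¹ Z^{(i)}(t)`, where `Z^{(i)}(t)(ω) = Z(t)(ω_i)`. -/
def maxStableField (Z : (Fin d → ℝ) → Ω → ℝ) (t : Fin d → ℝ) (w : (ℕ → ℝ) × (ℕ → Ω)) : ℝ≥0∞ :=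
  ⨆ i : ℕ, ENNReal.ofReal ((arrival i w.1)⁻¹ * Z t (w.2 i))

/-- Stationarity of a random field: its finite-dimensional distributions are shift-invariant. -/
def IsStationaryField {Ω' S : Type*} [MeasurableSpace Ω'] [MeasurableSpace S] (μ : Measure Ω')
    (X : (Fin d → ℝ) → Ω' → S) : Prop :=
  ∀ (h : Fin d → ℝ) (n : ℕ) (t : Fin n → (Fin d → ℝ)),
    IdentDistrib (fun w j => X (t j + h) w) (fun w j => X (t j) w) μ μ

/-- The cube `[0,T]^d`. -/
def cube (d : ℕ) (T : ℝ) : Set (Fin d → ℝ) := Set.Icc 0 (fun _ => T)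

/-- `∫_{[0,T]^d} 𝕀(Z(t) > s) dt`. -/
def sojourn (Z : (Fin d → ℝ) → Ω → ℝ) (T s : ℝ) (ω : Ω) : ℝ≥0∞ :=
  volume {t ∈ cube d T | s < Z t ω}

/-- `∫_0^∞ P( ∫_{[0,T]^d} 𝕀(Z(t) > s) dt > x ) ds`. -/
def bermanOnCube [MeasurableSpace Ω] (P : Measure Ω) (Z : (Fin d → ℝ) → Ω → ℝ) (T x : ℝ) : ℝ≥0∞ :=
  ∫⁻ s in Set.Ioi (0 : ℝ), P {ω | ENNReal.ofReal x < sojourn Z T s ω}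

/-- The Berman function: the limit as `T → ∞` of `T^{-d}` times `bermanOnCube P Z T x`. -/
def bermanFunction [MeasurableSpace Ω] (P : Measure Ω) (Z : (Fin d → ℝ) → Ω → ℝ) (x : ℝ) : ℝ≥0∞ :=
  limUnder atTop (fun T : ℝ => bermanOnCube P Z T x / ENNReal.ofReal (T ^ d))

end Berman

end

/-!
Let `V_T` be the sojourn time above `1` in `[0, T]^d`. The normalised tail of the max-stable field
is its exponent measure `ν`, the image of `P ⊗ ds` under `(ω, s) ↦ Z(ω) / s`: as `u → ∞`,
`u` times the probability that `X` exceeds `u x` at one of finitely many sites tends to the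
`ν`-measure of the paths that exceed `x` there. Hence stationarity of `X` makes `ν` invariant under
translation, and `bermanOnCube P Z T x` is `ν {x < V_T}`.

Spreading the mass of each path evenly over the times it spends above `1` and translating these
times to the origin gives, with `A` the set of paths that exceed `1` at the origin,
`T^{-d} ν {y < V_T} = ∫_{u ∈ [0,1]^d} ∫_A 1{V > y} V⁻¹ dν du`, where `V` is the sojourn time in
`[0, T]^d - T u`. As `T → ∞` this window increases to `ℝ^d`. For `y > 0` the integrand is dominated
by `y⁻¹`. For `y = 0` Fatou's lemma bounds the limit from below; from above, `[0, T]^d` is a union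
of at most `(2T)^d` unit cubes, and `ν {0 < V_1 ≤ y}` vanishes as `y → 0`.

The limit is continuous in `y` because the total sojourn time has no atoms under `ν` on `A`: a
continuous path has superlevel sets of a prescribed finite volume for at most one level.
-/

namespace Berman

open scoped NNReal

section ChangeOfVariables

lemma setLIntegral_comp_smul {E : Type*} [NormedAddCommGroup E] [NormedSpace ℝ E]
    [MeasurableSpace E] [BorelSpace E] [FiniteDimensional ℝ E] (μ : Measure E)
    [μ.IsAddHaarMeasure] (f : E → ℝ≥0∞) (s : Set E) {r : ℝ} (hr : r ≠ 0) :
    ∫⁻ x in (r • ·) ⁻¹' s, f (r • x) ∂μ =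
      ENNReal.ofReal |(r ^ Module.finrank ℝ E)⁻¹| * ∫⁻ x in s, f x ∂μ := by
  have hemb : MeasurableEmbedding fun x : E => r • x := measurableEmbedding_const_smul₀ hr
  rw [← hemb.lintegral_map, ← hemb.restrict_map, Measure.map_addHaar_smul μ hr,
    Measure.restrict_smul, lintegral_smul_measure, smul_eq_mul]

lemma ofReal_mul_setLIntegral_Ioi_comp_mul (f : ℝ → ℝ≥0∞) {u : ℝ} (hu : 0 < u) :
    ENNReal.ofReal u * ∫⁻ r in Set.Ioi (0 : ℝ), f (u * r) = ∫⁻ r in Set.Ioi (0 : ℝ), f r := by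
  have h := setLIntegral_comp_smul volume f (Set.Ioi 0) hu.ne'
  have hpre : (u • ·) ⁻¹' Set.Ioi (0 : ℝ) = Set.Ioi 0 := by ext r; simp [hu]
  rw [hpre, Module.finrank_self, pow_one, abs_of_pos (inv_pos.2 hu)] at h
  simp only [smul_eq_mul] at h
  rw [h, ← mul_assoc, ← ENNReal.ofReal_mul hu.le, mul_inv_cancel₀ hu.ne', ENNReal.ofReal_one,
    one_mul]

lemma tendsto_setLIntegral_exp_neg_div_mul {f : ℝ → ℝ≥0∞} (hf : Measurable f) :
    Tendsto (fun n : ℕ => ∫⁻ r in Set.Ioi (0 : ℝ),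
        ENNReal.ofReal (Real.exp (-(r / (n + 1)))) * f r) atTop
      (𝓝 (∫⁻ r in Set.Ioi (0 : ℝ), f r)) := by
  refine lintegral_tendsto_of_tendsto_of_monotone (fun n => by fun_prop) ?_ ?_
  · refine (ae_restrict_iff' measurableSet_Ioi).2 (.of_forall fun r hr m n hmn => ?_)
    have hr : (0 : ℝ) < r := hr
    dsimp only
    gcongr
  · refine .of_forall fun r => ?_
    have hdiv : Tendsto (fun n : ℕ => -(r / ((n : ℝ) + 1))) atTop (𝓝 0) := by
      simpa [div_eq_mul_inv] using
        ((tendsto_one_div_add_atTop_nhds_zero_nat (𝕜 := ℝ)).const_mul r).neg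
    have hexp : Tendsto (fun n : ℕ => Real.exp (-(r / ((n : ℝ) + 1)))) atTop (𝓝 1) := by
      simpa [Function.comp_def] using (Real.continuous_exp.tendsto 0).comp hdiv
    simpa using ENNReal.Tendsto.mul_const (b := f r) (ENNReal.tendsto_ofReal hexp) (.inl (by simp))

end ChangeOfVariables

section Renewal

lemma lintegral_expMeasure (r : ℝ) {f : ℝ → ℝ≥0∞} (hf : Measurable f) :
    ∫⁻ v, f v ∂(expMeasure r) =
      ∫⁻ v in Set.Ioi 0, ENNReal.ofReal (r * Real.exp (-(r * v))) * f v := by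
  have hdensity : expMeasure r = volume.withDensity (exponentialPDF r) := rfl
  have hpdf : Measurable (exponentialPDF r) := (measurable_exponentialPDFReal r).ennreal_ofReal
  rw [hdensity, lintegral_withDensity_eq_lintegral_mul _ hpdf hf,
    ← lintegral_indicator measurableSet_Ioi]
  refine lintegral_congr_ae ?_
  filter_upwards [Measure.ae_ne volume (0 : ℝ)] with v hv
  rcases lt_or_gt_of_ne hv with h0 | h0
  · simp [exponentialPDF_of_neg h0, not_lt.2 h0.le]
  · simp [exponentialPDF_of_nonneg h0.le, h0]

lemma expMeasure_Iio {r : ℝ} (hr : 0 < r) (w : ℝ) :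
    expMeasure r (Set.Iio w) = ENNReal.ofReal (1 - Real.exp (-(r * w))) := by
  have hdensity : expMeasure r = volume.withDensity (exponentialPDF r) := rfl
  rw [hdensity, withDensity_apply _ measurableSet_Iio, setLIntegral_congr Iio_ae_eq_Iic,
    lintegral_exponentialPDF_eq_antiDeriv hr]
  split_ifs with hw
  · rfl
  · have : 1 ≤ Real.exp (-(r * w)) := Real.one_le_exp (by nlinarith)
    rw [ENNReal.ofReal_zero, ENNReal.ofReal_of_nonpos (by linarith)]

lemma lintegral_lintegral_add_expMeasure {r : ℝ} (hr : 0 < r) {f : ℝ → ℝ≥0∞}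
    (hf : Measurable f) :
    ∫⁻ u in Set.Ioi (0 : ℝ), ∫⁻ v, f (u + v) ∂(expMeasure r) =
      ∫⁻ w in Set.Ioi (0 : ℝ), ENNReal.ofReal (1 - Real.exp (-(r * w))) * f w := by
  have : IsProbabilityMeasure (expMeasure r) := isProbabilityMeasure_expMeasure hr
  have hshift : ∀ v : ℝ, ∫⁻ u in Set.Ioi (0 : ℝ), f (u + v) =
      ∫⁻ w, (Set.Iio w).indicator 1 v * f w := by
    intro v
    rw [← lintegral_indicator measurableSet_Ioi,
      ← lintegral_add_right_eq_self (fun w => (Set.Iio w).indicator (1 : ℝ → ℝ≥0∞) v * f w) v]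
    refine lintegral_congr fun u => ?_
    by_cases hu : 0 < u <;> simp [hu]
  have hmeas : Measurable (Function.uncurry fun v w : ℝ =>
      (Set.Iio w).indicator (1 : ℝ → ℝ≥0∞) v * f w) :=
    ((measurable_const (a := (1 : ℝ≥0∞))).indicator
      (measurableSet_lt measurable_fst measurable_snd)).mul (hf.comp measurable_snd)
  have hvanish : ∀ w : ℝ, expMeasure r (Set.Iio w) * f w = (Set.Ioi (0 : ℝ)).indicator
      (fun w => ENNReal.ofReal (1 - Real.exp (-(r * w))) * f w) w := by
    intro w
    rw [expMeasure_Iio hr]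
    by_cases hw : 0 < w
    · simp [hw]
    · have : 1 ≤ Real.exp (-(r * w)) := Real.one_le_exp (by nlinarith)
      simp [hw, ENNReal.ofReal_of_nonpos (sub_nonpos.2 this)]
  calc ∫⁻ u in Set.Ioi (0 : ℝ), ∫⁻ v, f (u + v) ∂(expMeasure r)
      = ∫⁻ v, (∫⁻ u in Set.Ioi (0 : ℝ), f (u + v)) ∂(expMeasure r) :=
        lintegral_lintegral_swap (Measurable.aemeasurable (by fun_prop))
    _ = ∫⁻ v, (∫⁻ w, (Set.Iio w).indicator 1 v * f w) ∂(expMeasure r) := by simp_rw [hshift]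
    _ = ∫⁻ w, ∫⁻ v, (Set.Iio w).indicator 1 v * f w ∂(expMeasure r) :=
        lintegral_lintegral_swap hmeas.aemeasurable
    _ = ∫⁻ w, expMeasure r (Set.Iio w) * f w := by
        refine lintegral_congr fun w => ?_
        rw [lintegral_mul_const _ (measurable_one.indicator measurableSet_Iio),
          lintegral_indicator_one measurableSet_Iio]
    _ = _ := by simp_rw [hvanish]; exact lintegral_indicator measurableSet_Ioi _

instance isProbabilityMeasure_expMeasure_one : IsProbabilityMeasure (expMeasure 1) :=
  isProbabilityMeasure_expMeasure one_pos

/-- The law of a sequence of independent unit exponential variables, that is, the first marginal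
of `deHaanMeasure`. -/
noncomputable abbrev expSequence : Measure (ℕ → ℝ) := Measure.infinitePi fun _ : ℕ => expMeasure 1

@[fun_prop]
lemma measurable_arrival (i : ℕ) : Measurable (arrival i) := by
  unfold arrival
  fun_prop

lemma arrival_zero (v : ℕ → ℝ) : arrival 0 v = v 0 := by simp [arrival]

lemma arrival_succ (i : ℕ) (v : ℕ → ℝ) : arrival (i + 1) v = arrival i v + v (i + 1) :=
  Finset.sum_range_succ _ _

lemma ae_arrival_nonneg : ∀ᵐ v ∂expSequence, ∀ i, 0 ≤ arrival i v := by
  have hexp : ∀ᵐ u ∂(expMeasure 1), 0 ≤ u := by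
    have : expMeasure 1 (Set.Iio 0) = 0 := by simp [expMeasure_Iio one_pos]
    rw [ae_iff]
    simpa [Set.Iio] using this
  have hcoord : ∀ᵐ v ∂expSequence, ∀ k, 0 ≤ v k := ae_all_iff.2 fun k =>
    (measurePreserving_eval_infinitePi (fun _ : ℕ => expMeasure 1) k).quasiMeasurePreserving.ae hexp
  filter_upwards [hcoord] with v hv i
  exact Finset.sum_nonneg fun k _ => hv k

lemma lintegral_arrival_zero {f : ℝ → ℝ≥0∞} (hf : Measurable f) :
    ∫⁻ v, f (arrival 0 v) ∂expSequence =
      ∫⁻ u in Set.Ioi 0, ENNReal.ofReal (Real.exp (-u)) * f u := by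
  simp_rw [arrival_zero]
  rw [(measurePreserving_eval_infinitePi (fun _ : ℕ => expMeasure 1) 0).lintegral_comp hf,
    lintegral_expMeasure 1 hf]
  simp only [one_mul]

lemma lintegral_arrival_succ (i : ℕ) {f : ℝ → ℝ≥0∞} (hf : Measurable f) :
    ∫⁻ v, f (arrival (i + 1) v) ∂expSequence =
      ∫⁻ v, ∫⁻ u, f (arrival i v + u) ∂(expMeasure 1) ∂expSequence := by
  have hindep : IndepFun (arrival i) (fun v : ℕ → ℝ => v (i + 1)) expSequence := by
    have h := (iIndepFun_infinitePi (P := fun _ : ℕ => expMeasure 1) (X := fun _ x => x)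
      (fun _ => measurable_id)).indepFun_finsetSum_of_notMem (fun i => measurable_pi_apply i)
      (s := Finset.range (i + 1)) (i := i + 1) (by simp)
    convert h using 1
    ext v
    simp [arrival]
  have hprod := (indepFun_iff_map_prod_eq_prod_map_map (measurable_arrival i).aemeasurable
    (measurable_pi_apply (i + 1)).aemeasurable).1 hindep
  have heval : expSequence.map (fun v : ℕ → ℝ => v (i + 1)) = expMeasure 1 :=
    (measurePreserving_eval_infinitePi (fun _ : ℕ => expMeasure 1) (i + 1)).map_eq
  have hadd : Measurable fun p : ℝ × ℝ => f (p.1 + p.2) := by fun_prop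
  calc ∫⁻ v, f (arrival (i + 1) v) ∂expSequence
      = ∫⁻ p, f (p.1 + p.2) ∂(expSequence.map fun v => (arrival i v, v (i + 1))) := by
        rw [lintegral_map hadd (by fun_prop)]
        simp_rw [arrival_succ]
    _ = ∫⁻ a, ∫⁻ u, f (a + u) ∂(expMeasure 1) ∂(expSequence.map (arrival i)) := by
        rw [hprod, heval, lintegral_prod _ hadd.aemeasurable]
    _ = _ := lintegral_map hadd.lintegral_prod_right' (measurable_arrival i)

lemma sum_lintegral_arrival_le (n : ℕ) {f : ℝ → ℝ≥0∞} (hf : Measurable f) :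
    ∑ i ∈ Finset.range n, ∫⁻ v, f (arrival i v) ∂expSequence ≤ ∫⁻ u in Set.Ioi (0 : ℝ), f u := by
  induction n generalizing f with
  | zero => simp
  | succ n ih =>
    have hconv : Measurable fun a : ℝ => ∫⁻ u, f (a + u) ∂(expMeasure 1) :=
      Measurable.lintegral_prod_right' (f := fun p : ℝ × ℝ => f (p.1 + p.2)) (by fun_prop)
    have htotal : ∀ w ∈ Set.Ioi (0 : ℝ), ENNReal.ofReal (1 - Real.exp (-(1 * w))) * f w +
        ENNReal.ofReal (Real.exp (-w)) * f w = f w := by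
      intro w hw
      have : Real.exp (-w) ≤ 1 := Real.exp_le_one_iff.2 (by simpa using (Set.mem_Ioi.1 hw).le)
      rw [one_mul, ← add_mul, ← ENNReal.ofReal_add (by linarith) (Real.exp_pos _).le]
      simp
    calc ∑ i ∈ Finset.range (n + 1), ∫⁻ v, f (arrival i v) ∂expSequence
        = ∑ i ∈ Finset.range n, ∫⁻ v, ∫⁻ u, f (arrival i v + u) ∂(expMeasure 1) ∂expSequence +
            ∫⁻ v, f (arrival 0 v) ∂expSequence := by
          rw [Finset.sum_range_succ']
          simp_rw [lintegral_arrival_succ _ hf]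
      _ ≤ (∫⁻ a in Set.Ioi (0 : ℝ), ∫⁻ u, f (a + u) ∂(expMeasure 1)) +
            ∫⁻ w in Set.Ioi (0 : ℝ), ENNReal.ofReal (Real.exp (-w)) * f w := by
          rw [lintegral_arrival_zero hf]
          gcongr
          exact ih hconv
      _ = ∫⁻ w in Set.Ioi (0 : ℝ), f w := by
          rw [lintegral_lintegral_add_expMeasure one_pos hf, ← lintegral_add_left (by fun_prop)]
          exact setLIntegral_congr_fun measurableSet_Ioi htotal

lemma tsum_lintegral_arrival_le {f : ℝ → ℝ≥0∞} (hf : Measurable f) :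
    ∑' i, ∫⁻ v, f (arrival i v) ∂expSequence ≤ ∫⁻ u in Set.Ioi (0 : ℝ), f u := by
  rw [ENNReal.tsum_eq_iSup_nat]
  exact iSup_le fun n => sum_lintegral_arrival_le n hf

end Renewal

section MaxStable

variable {Ω ι : Type*} [MeasurableSpace Ω] (P : Measure Ω) {d : ℕ} {Z : (Fin d → ℝ) → Ω → ℝ}

/-- The probability that the field exceeds, at one of the sites `t j`, the level `r * x j`. Its
integral over `r > 0` is the mass that the exponent measure gives to exceeding a level `x j`. -/
noncomputable def exceedProb (Z : (Fin d → ℝ) → Ω → ℝ) (t : ι → Fin d → ℝ) (x : ι → ℝ)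
    (r : ℝ) : ℝ≥0∞ :=
  P {ω | ∃ j, r * x j < Z (t j) ω}

/-- The event that the max-stable field exceeds, at one of the sites `t j`, the level `u * x j`. -/
def maxExceed {Ω : Type*} (Z : (Fin d → ℝ) → Ω → ℝ) (t : ι → Fin d → ℝ) (x : ι → ℝ) (u : ℝ) :
    Set ((ℕ → ℝ) × (ℕ → Ω)) :=
  {w | ∃ j, ENNReal.ofReal (u * x j) < maxStableField Z (t j) w}

/-- The event that the point `Γ_i⁻¹ Z^{(i)}` of the de Haan representation exceeds, at one of the
sites `t j`, the level `u * x j`. The condition `0 < Γ_i` excludes the junk value of `0⁻¹`. -/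
def pointExceed {Ω : Type*} (Z : (Fin d → ℝ) → Ω → ℝ) (t : ι → Fin d → ℝ) (x : ι → ℝ) (u : ℝ)
    (i : ℕ) : Set ((ℕ → ℝ) × (ℕ → Ω)) :=
  {w | 0 < arrival i w.1 ∧ ∃ j, (u * arrival i w.1) * x j < Z (t j) (w.2 i)}

lemma mem_maxExceed_iff {Ω : Type*} {Z : (Fin d → ℝ) → Ω → ℝ} {t : ι → Fin d → ℝ} {x : ι → ℝ}
    (hx : ∀ j, 0 < x j) {u : ℝ} (hu : 0 < u) {w : (ℕ → ℝ) × (ℕ → Ω)}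
    (hw : ∀ i, 0 ≤ arrival i w.1) :
    w ∈ maxExceed Z t x u ↔ ∃ i, w ∈ pointExceed Z t x u i := by
  have hpoint : ∀ i j, ENNReal.ofReal (u * x j) <
      ENNReal.ofReal ((arrival i w.1)⁻¹ * Z (t j) (w.2 i)) ↔
      0 < arrival i w.1 ∧ (u * arrival i w.1) * x j < Z (t j) (w.2 i) := by
    intro i j
    have hux : 0 < u * x j := mul_pos hu (hx j)
    rw [ENNReal.ofReal_lt_ofReal_iff_of_nonneg hux.le]
    rcases (hw i).eq_or_lt with h0 | h0
    · simp [← h0, hux.le]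
    · rw [inv_mul_eq_div, lt_div_iff₀ h0, mul_right_comm]
      simp only [h0, true_and]
  simp only [maxExceed, pointExceed, Set.mem_ofPred_eq, maxStableField, lt_iSup_iff, hpoint,
    ← exists_and_left]
  exact exists_comm

section

variable [Finite ι]

lemma measurableSet_exists_mul_lt (hmeas : ∀ t, Measurable (Z t)) (t : ι → Fin d → ℝ)
    (x : ι → ℝ) : MeasurableSet {p : ℝ × Ω | ∃ j, p.1 * x j < Z (t j) p.2} := by
  rw [Set.ofPred_exists]
  exact MeasurableSet.iUnion fun j => measurableSet_lt (by fun_prop)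
    ((hmeas (t j)).comp measurable_snd)

lemma measurable_exceedProb [SFinite P] (hmeas : ∀ t, Measurable (Z t)) (t : ι → Fin d → ℝ)
    (x : ι → ℝ) : Measurable (exceedProb P Z t x) :=
  measurable_measure_prodMk_left (measurableSet_exists_mul_lt hmeas t x)

variable [IsProbabilityMeasure P]

lemma deHaanMeasure_maxExceed_shift
    (hstat : IsStationaryField (deHaanMeasure P) (maxStableField Z)) (t : ι → Fin d → ℝ)
    (x : ι → ℝ) (u : ℝ) (h : Fin d → ℝ) :
    deHaanMeasure P (maxExceed Z (fun j => t j + h) x u) =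
      deHaanMeasure P (maxExceed Z t x u) := by
  obtain ⟨n, ⟨e⟩⟩ := Finite.exists_equiv_fin ι
  let S : Set (Fin n → ℝ≥0∞) := {y | ∃ j, ENNReal.ofReal (u * x (e.symm j)) < y j}
  have hS : MeasurableSet S := by
    simp only [S, Set.ofPred_exists]
    exact MeasurableSet.iUnion fun j => measurableSet_lt measurable_const (by fun_prop)
  have hpre : ∀ s : ι → Fin d → ℝ, maxExceed Z s x u =
      (fun w j => maxStableField Z (s (e.symm j)) w) ⁻¹' S := by
    intro s
    ext w
    exact e.exists_congr_left
  rw [hpre, hpre]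
  exact (hstat h n fun j => t (e.symm j)).measure_mem_eq hS

lemma ae_deHaanMeasure_arrival_nonneg :
    ∀ᵐ w ∂(deHaanMeasure P), ∀ i, 0 ≤ arrival i w.1 :=
  Measure.quasiMeasurePreserving_fst.ae ae_arrival_nonneg

lemma deHaanMeasure_pointExceed (hmeas : ∀ t, Measurable (Z t)) (t : ι → Fin d → ℝ) (x : ι → ℝ)
    (u : ℝ) (i : ℕ) :
    deHaanMeasure P (pointExceed Z t x u i) =
      ∫⁻ v, (Set.Ioi (0 : ℝ)).indicator (fun r => exceedProb P Z t x (u * r)) (arrival i v)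
        ∂expSequence := by
  have hS := measurableSet_exists_mul_lt hmeas t x
  have hpoint : MeasurableSet (pointExceed Z t x u i) := by
    refine MeasurableSet.inter (measurableSet_lt measurable_const
      ((measurable_arrival i).comp measurable_fst)) ?_
    have : Measurable fun w : (ℕ → ℝ) × (ℕ → Ω) => (u * arrival i w.1, w.2 i) := by fun_prop
    exact this hS
  rw [deHaanMeasure, Measure.prod_apply hpoint]
  refine lintegral_congr fun v => ?_
  by_cases hv : 0 < arrival i v
  · have hE : MeasurableSet {ω | ∃ j, (u * arrival i v) * x j < Z (t j) ω} :=
      (measurable_prodMk_left (x := u * arrival i v)) hS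
    have := (measurePreserving_eval_infinitePi (fun _ : ℕ => P) i).measure_preimage
      hE.nullMeasurableSet
    simpa [pointExceed, hv, exceedProb] using this
  · simp [pointExceed, hv]

lemma deHaanMeasure_maxExceed_le (hmeas : ∀ t, Measurable (Z t)) (t : ι → Fin d → ℝ)
    {x : ι → ℝ} (hx : ∀ j, 0 < x j) {u : ℝ} (hu : 0 < u) :
    deHaanMeasure P (maxExceed Z t x u) ≤
      ∫⁻ r in Set.Ioi (0 : ℝ), exceedProb P Z t x (u * r) := by
  have hprob : Measurable fun r => exceedProb P Z t x (u * r) :=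
    (measurable_exceedProb P hmeas t x).comp (by fun_prop)
  calc deHaanMeasure P (maxExceed Z t x u)
      ≤ deHaanMeasure P (⋃ i, pointExceed Z t x u i) := by
        refine measure_mono_ae ?_
        filter_upwards [ae_deHaanMeasure_arrival_nonneg P] with w hw h
        exact Set.mem_iUnion.2 ((mem_maxExceed_iff hx hu hw).1 h)
    _ ≤ ∑' i, deHaanMeasure P (pointExceed Z t x u i) := measure_iUnion_le _
    _ ≤ ∫⁻ r in Set.Ioi (0 : ℝ), (Set.Ioi (0 : ℝ)).indicator
          (fun r => exceedProb P Z t x (u * r)) r := by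
        simp_rw [deHaanMeasure_pointExceed P hmeas]
        exact tsum_lintegral_arrival_le (hprob.indicator measurableSet_Ioi)
    _ = _ := by rw [setLIntegral_indicator measurableSet_Ioi, Set.inter_self]

lemma le_deHaanMeasure_maxExceed (hmeas : ∀ t, Measurable (Z t)) (t : ι → Fin d → ℝ)
    {x : ι → ℝ} (hx : ∀ j, 0 < x j) {u : ℝ} (hu : 0 < u) :
    ∫⁻ r in Set.Ioi (0 : ℝ), ENNReal.ofReal (Real.exp (-r)) * exceedProb P Z t x (u * r) ≤
      deHaanMeasure P (maxExceed Z t x u) := by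
  have hprob : Measurable fun r => exceedProb P Z t x (u * r) :=
    (measurable_exceedProb P hmeas t x).comp (by fun_prop)
  calc ∫⁻ r in Set.Ioi (0 : ℝ), ENNReal.ofReal (Real.exp (-r)) * exceedProb P Z t x (u * r)
      = deHaanMeasure P (pointExceed Z t x u 0) := by
        rw [deHaanMeasure_pointExceed P hmeas,
          lintegral_arrival_zero (hprob.indicator measurableSet_Ioi)]
        exact setLIntegral_congr_fun measurableSet_Ioi fun r hr => by
          simp only [Set.indicator_of_mem hr]
    _ ≤ deHaanMeasure P (maxExceed Z t x u) := by
        refine measure_mono_ae ?_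
        filter_upwards [ae_deHaanMeasure_arrival_nonneg P] with w hw h
        exact (mem_maxExceed_iff hx hu hw).2 ⟨0, h⟩

lemma tendsto_mul_deHaanMeasure_maxExceed (hmeas : ∀ t, Measurable (Z t)) (t : ι → Fin d → ℝ)
    {x : ι → ℝ} (hx : ∀ j, 0 < x j) :
    Tendsto (fun n : ℕ => ENNReal.ofReal (n + 1) * deHaanMeasure P (maxExceed Z t x (n + 1)))
      atTop (𝓝 (∫⁻ r in Set.Ioi (0 : ℝ), exceedProb P Z t x r)) := by
  refine tendsto_of_tendsto_of_tendsto_of_le_of_le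
    (tendsto_setLIntegral_exp_neg_div_mul (measurable_exceedProb P hmeas t x))
    tendsto_const_nhds (fun n => ?_) (fun n => ?_) <;>
    have hu : (0 : ℝ) < n + 1 := by positivity
  · dsimp only
    rw [← ofReal_mul_setLIntegral_Ioi_comp_mul _ hu]
    gcongr
    simp_rw [mul_div_cancel_left₀ _ hu.ne']
    exact le_deHaanMeasure_maxExceed P hmeas t hx hu
  · dsimp only
    rw [← ofReal_mul_setLIntegral_Ioi_comp_mul _ hu]
    gcongr
    exact deHaanMeasure_maxExceed_le P hmeas t hx hu

theorem lintegral_exceedProb_shift (hmeas : ∀ t, Measurable (Z t))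
    (hstat : IsStationaryField (deHaanMeasure P) (maxStableField Z)) (t : ι → Fin d → ℝ)
    {x : ι → ℝ} (hx : ∀ j, 0 < x j) (h : Fin d → ℝ) :
    ∫⁻ r in Set.Ioi (0 : ℝ), exceedProb P Z (fun j => t j + h) x r =
      ∫⁻ r in Set.Ioi (0 : ℝ), exceedProb P Z t x r := by
  refine tendsto_nhds_unique (tendsto_mul_deHaanMeasure_maxExceed P hmeas _ hx) ?_
  simp_rw [deHaanMeasure_maxExceed_shift P hstat]
  exact tendsto_mul_deHaanMeasure_maxExceed P hmeas t hx

end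

end MaxStable

section InvAbove

/-- The reciprocal `v⁻¹` cut off to zero for `v ≤ y`: the weight of each unit of visiting time in
an orbit that is counted only if its visiting time exceeds `y`. -/
noncomputable def invAbove (y : ℝ≥0∞) : ℝ≥0∞ → ℝ≥0∞ := (Set.Ioi y).indicator (·⁻¹)

@[fun_prop]
lemma measurable_invAbove (y : ℝ≥0∞) : Measurable (invAbove y) :=
  measurable_inv.indicator measurableSet_Ioi

lemma invAbove_of_lt {y v : ℝ≥0∞} (h : y < v) : invAbove y v = v⁻¹ := by
  simp [invAbove, h]

lemma invAbove_of_le {y v : ℝ≥0∞} (h : v ≤ y) : invAbove y v = 0 := by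
  simp [invAbove, h]

lemma invAbove_le_inv (y v : ℝ≥0∞) : invAbove y v ≤ y⁻¹ := by
  rcases lt_or_ge y v with h | h
  · rw [invAbove_of_lt h]
    exact ENNReal.inv_le_inv.2 h.le
  · simp [invAbove_of_le h]

lemma antitone_invAbove : Antitone invAbove := fun _ _ h v =>
  Set.indicator_le_indicator_of_subset (Set.Ioi_subset_Ioi h) (fun _ => zero_le) v

lemma tendsto_invAbove_of_le {α : Type*} {l : Filter α} {V : α → ℝ≥0∞} {v : ℝ≥0∞} (y : ℝ≥0∞)
    (hV : Tendsto V l (𝓝 v)) (hle : ∀ a, V a ≤ v) :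
    Tendsto (fun a => invAbove y (V a)) l (𝓝 (invAbove y v)) := by
  rcases lt_or_ge y v with h | h
  · rw [invAbove_of_lt h]
    refine hV.inv.congr' ?_
    filter_upwards [hV.eventually_const_lt h] with a ha
    rw [invAbove_of_lt ha]
  · rw [invAbove_of_le h]
    refine tendsto_const_nhds.congr fun a => ?_
    rw [invAbove_of_le ((hle a).trans h)]

lemma continuousAt_invAbove_level {y v : ℝ≥0∞} (h : v = 0 ∨ v ≠ y) :
    ContinuousAt (fun z => invAbove z v) y := by
  rcases h with rfl | h
  · simp only [invAbove_of_le (zero_le (a := _))]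
    exact continuousAt_const
  rcases lt_or_gt_of_ne h with h | h
  · refine (continuousAt_const (y := (0 : ℝ≥0∞))).congr ?_
    filter_upwards [lt_mem_nhds h] with z hz
    rw [invAbove_of_le hz.le]
  · refine (continuousAt_const (y := v⁻¹)).congr ?_
    filter_upwards [gt_mem_nhds h] with z hz
    rw [invAbove_of_lt hz]

end InvAbove

section Visits

variable {G E : Type*} [AddGroup G] [MeasureSpace G] [AddAction G E]

/-- The volume of the set of times `t ∈ Q` at which the orbit `t +ᵥ x` visits `A`. For the
translation of paths and `A` the set of paths that exceed `1` at the origin, this is the sojourn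
time above the level `1`. -/
noncomputable def visitVolume (A : Set E) (Q : Set G) (x : E) : ℝ≥0∞ :=
  volume {t ∈ Q | t +ᵥ x ∈ A}

lemma visitVolume_mono (A : Set E) {Q R : Set G} (h : Q ⊆ R) (x : E) :
    visitVolume A Q x ≤ visitVolume A R x :=
  measure_mono fun _ ht => ⟨h ht.1, ht.2⟩

lemma visitVolume_le (A : Set E) (Q : Set G) (x : E) : visitVolume A Q x ≤ volume Q :=
  measure_mono fun _ ht => ht.1

lemma visitVolume_iUnion_le (A : Set E) {κ : Type*} [Fintype κ] (Q : κ → Set G) (x : E) :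
    visitVolume A (⋃ k, Q k) x ≤ ∑ k, visitVolume A (Q k) x := by
  refine (measure_mono ?_).trans (measure_iUnion_fintype_le volume fun k => {t ∈ Q k | t +ᵥ x ∈ A})
  rintro t ⟨ht, hA⟩
  obtain ⟨k, hk⟩ := Set.mem_iUnion.1 ht
  exact Set.mem_iUnion.2 ⟨k, hk, hA⟩

lemma visitVolume_vadd [MeasurableAdd G] [(volume : Measure G).IsAddRightInvariant] (A : Set E)
    (Q : Set G) (a : G) (x : E) :
    visitVolume A Q (a +ᵥ x) = visitVolume A ((· - a) ⁻¹' Q) x := by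
  have h := measure_preimage_add_right volume a {t ∈ (· - a) ⁻¹' Q | t +ᵥ x ∈ A}
  simpa only [visitVolume, Set.preimage_ofPred_eq, Set.mem_preimage, add_sub_cancel_right,
    add_vadd] using h

lemma tendsto_visitVolume_iUnion (A : Set E) {Q : ℝ → Set G} (hQ : Monotone Q) (x : E) :
    Tendsto (fun T => visitVolume A (Q T) x) atTop (𝓝 (visitVolume A (⋃ T, Q T) x)) := by
  have hmono : Monotone fun T => {t ∈ Q T | t +ᵥ x ∈ A} := fun S T hST t ht => ⟨hQ hST ht.1, ht.2⟩
  have hunion : {t ∈ ⋃ T, Q T | t +ᵥ x ∈ A} = ⋃ T, {t ∈ Q T | t +ᵥ x ∈ A} := by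
    ext t
    simp
  rw [visitVolume, hunion]
  exact tendsto_measure_iUnion_atTop hmono

variable [MeasurableSpace E] {A : Set E} {Q : Set G}

variable [MeasurableVAdd₂ G E] [SFinite (volume : Measure G)]

lemma measurable_visitVolume (hA : MeasurableSet A) (hQ : MeasurableSet Q) :
    Measurable (visitVolume A Q) :=
  measurable_measure_prodMk_left (s := {p : E × G | p.2 ∈ Q ∧ p.2 +ᵥ p.1 ∈ A})
    ((measurable_snd hQ).inter ((measurable_snd.vadd measurable_fst) hA))

variable {ν : Measure E} [SFinite ν] [VAddInvariantMeasure G E ν]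

theorem lintegral_visitVolume_mul (hA : MeasurableSet A) {F : E → ℝ≥0∞} (hF : Measurable F) :
    ∫⁻ x, visitVolume A Q x * F x ∂ν = ∫⁻ t in Q, ∫⁻ x in A, F (-t +ᵥ x) ∂ν := by
  have hvisit : MeasurableSet {p : E × G | p.2 +ᵥ p.1 ∈ A} :=
    (measurable_snd.vadd measurable_fst) hA
  have htimes : ∀ x : E, MeasurableSet {t : G | t +ᵥ x ∈ A} := fun x =>
    measurable_prodMk_left hvisit
  have hvolume : ∀ x, ∫⁻ t in Q, {t : G | t +ᵥ x ∈ A}.indicator 1 t = visitVolume A Q x := by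
    intro x
    rw [lintegral_indicator_one (htimes x), Measure.restrict_apply (htimes x), Set.inter_comm]
    rfl
  calc ∫⁻ x, visitVolume A Q x * F x ∂ν
      = ∫⁻ x, (∫⁻ t in Q, {t : G | t +ᵥ x ∈ A}.indicator 1 t * F x) ∂ν := by
        refine lintegral_congr fun x => ?_
        rw [lintegral_mul_const _ (measurable_one.indicator (htimes x)), hvolume]
    _ = ∫⁻ t in Q, ∫⁻ x, {t : G | t +ᵥ x ∈ A}.indicator 1 t * F x ∂ν :=
        lintegral_lintegral_swap
          ((measurable_one.indicator hvisit).mul (hF.comp measurable_fst)).aemeasurable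
    _ = ∫⁻ t in Q, ∫⁻ x, A.indicator (fun x => F (-t +ᵥ x)) (t +ᵥ x) ∂ν := by
        refine lintegral_congr fun t => lintegral_congr fun x => ?_
        by_cases h : t +ᵥ x ∈ A <;> simp [h]
    _ = ∫⁻ t in Q, ∫⁻ x in A, F (-t +ᵥ x) ∂ν := by
        refine lintegral_congr fun t => ?_
        rw [← lintegral_indicator hA]
        exact (measurePreserving_vadd t ν).lintegral_comp
          ((hF.comp (measurable_const_vadd (-t))).indicator hA)

lemma measure_le_measure_visitVolume_pos (hA : MeasurableSet A) (hQ : MeasurableSet Q)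
    (hQ0 : volume Q ≠ 0) (hQtop : volume Q ≠ ∞) : ν A ≤ ν {x | 0 < visitVolume A Q x} := by
  have hmass : ν A * volume Q = ∫⁻ x, visitVolume A Q x ∂ν := by
    simpa using (lintegral_visitVolume_mul hA (ν := ν) (F := 1) measurable_one).symm
  have hpos : MeasurableSet {x | 0 < visitVolume A Q x} :=
    measurable_visitVolume hA hQ measurableSet_Ioi
  rw [← ENNReal.mul_le_mul_iff_left hQ0 hQtop, hmass, mul_comm, ← lintegral_indicator_const hpos]
  refine lintegral_mono fun x => ?_
  by_cases hx : 0 < visitVolume A Q x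
  · simpa [hx] using visitVolume_le A Q x
  · simp [not_lt.1 hx]

lemma measure_lt_visitVolume (hA : MeasurableSet A) (hQ : MeasurableSet Q)
    (hQtop : volume Q ≠ ∞) (y : ℝ≥0∞) :
    ν {x | y < visitVolume A Q x} =
      ∫⁻ t in Q, ∫⁻ x in A, invAbove y (visitVolume A Q (-t +ᵥ x)) ∂ν := by
  have hV := measurable_visitVolume (E := E) hA hQ
  refine Eq.trans ?_ (lintegral_visitVolume_mul hA ((measurable_invAbove y).comp hV))
  rw [← lintegral_indicator_one (measurableSet_lt measurable_const hV)]
  refine lintegral_congr fun x => ?_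
  have hx : visitVolume A Q x ≠ ∞ := ne_top_of_le_ne_top hQtop (visitVolume_le A Q x)
  rcases lt_or_ge y (visitVolume A Q x) with h | h
  · simp [h, invAbove_of_lt h, ENNReal.mul_inv_cancel (pos_of_gt h).ne' hx]
  · simp [not_lt.2 h, invAbove_of_le h]

end Visits

section Cubes

variable {d : ℕ}

lemma measurableSet_cube (T : ℝ) : MeasurableSet (cube d T) := measurableSet_Icc

lemma volume_cube {T : ℝ} (hT : 0 ≤ T) : volume (cube d T) = ENNReal.ofReal (T ^ d) := by
  simp [cube, Real.volume_Icc_pi, ENNReal.ofReal_pow hT]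

lemma volume_cube_one : volume (cube d 1) = 1 := by simp [volume_cube]

lemma volume_cube_ne_top (T : ℝ) : volume (cube d T) ≠ ∞ := isCompact_Icc.measure_lt_top.ne

lemma mem_cube_iff {T : ℝ} {t : Fin d → ℝ} : t ∈ cube d T ↔ ∀ i, 0 ≤ t i ∧ t i ≤ T := by
  simp only [cube, Set.mem_Icc, Pi.le_def, Pi.zero_apply, forall_and]

lemma ae_cube_interior :
    ∀ᵐ u ∂(volume.restrict (cube d 1)), ∀ i, 0 < u i ∧ u i < 1 := by
  have h : (Set.univ.pi fun i : Fin d => Set.Ioo ((0 : Fin d → ℝ) i) 1) =ᵐ[volume] cube d 1 :=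
    Measure.univ_pi_Ioo_ae_eq_Icc (μ := fun _ : Fin d => (volume : Measure ℝ))
  rw [← Measure.restrict_congr_set h]
  refine (ae_restrict_iff' (MeasurableSet.univ_pi fun i => measurableSet_Ioo)).2 ?_
  exact .of_forall fun u hu i => hu i (Set.mem_univ i)

lemma lintegral_cube_smul (f : (Fin d → ℝ) → ℝ≥0∞) {T : ℝ} (hT : 0 < T) :
    ∫⁻ t in cube d T, f t = ENNReal.ofReal (T ^ d) * ∫⁻ u in cube d 1, f (T • u) := by
  have hpre : (T • ·) ⁻¹' cube d T = cube d 1 := by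
    ext u
    simp only [Set.mem_preimage, mem_cube_iff, Pi.smul_apply, smul_eq_mul,
      mul_nonneg_iff_of_pos_left hT, mul_le_iff_le_one_right hT]
  have h := setLIntegral_comp_smul volume f (cube d T) hT.ne'
  rw [hpre, Module.finrank_fin_fun, abs_of_pos (by positivity)] at h
  rw [h, ← mul_assoc, ← ENNReal.ofReal_mul (by positivity), mul_inv_cancel₀ (by positivity),
    ENNReal.ofReal_one, one_mul]

lemma monotone_cube_sub_smul {u : Fin d → ℝ} (hu : ∀ i, 0 < u i ∧ u i < 1) :
    Monotone fun T : ℝ => (· + T • u) ⁻¹' cube d T := by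
  intro S T hST s hs
  simp only [Set.mem_preimage, mem_cube_iff, Pi.add_apply, Pi.smul_apply, smul_eq_mul] at hs ⊢
  intro i
  have hlower := mul_nonneg (sub_nonneg.2 hST) (hu i).1.le
  have hupper := mul_nonneg (sub_nonneg.2 hST) (sub_nonneg.2 (hu i).2.le)
  constructor
  · linarith [(hs i).1]
  · linarith [(hs i).2]

lemma iUnion_cube_sub_smul {u : Fin d → ℝ} (hu : ∀ i, 0 < u i ∧ u i < 1) :
    ⋃ T : ℝ, (· + T • u) ⁻¹' cube d T = Set.univ := by
  refine Set.eq_univ_of_forall fun s => Set.mem_iUnion.2 ?_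
  have h : ∀ᶠ T : ℝ in atTop, ∀ i, 0 ≤ s i + T * u i ∧ s i + T * u i ≤ T := by
    refine eventually_all.2 fun i => ?_
    filter_upwards [eventually_ge_atTop (-s i / u i), eventually_ge_atTop (s i / (1 - u i))]
      with T hlower hupper
    rw [div_le_iff₀ (hu i).1] at hlower
    rw [div_le_iff₀ (sub_pos.2 (hu i).2)] at hupper
    constructor <;> linarith
  obtain ⟨T, hT⟩ := h.exists
  exact ⟨T, mem_cube_iff.2 hT⟩

/-- The lower corners of the unit cubes by which `[0,T]^d` is covered from inside. -/
noncomputable def corner (T : ℝ) (k : Fin d → Fin ⌈T⌉₊) : Fin d → ℝ :=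
  fun i => min (k i : ℝ) (T - 1)

lemma exists_corner_le_le {T t : ℝ} (hT : 1 ≤ T) (h0 : 0 ≤ t) (ht : t ≤ T) :
    ∃ k : Fin ⌈T⌉₊, min (k : ℝ) (T - 1) ≤ t ∧ t ≤ min (k : ℝ) (T - 1) + 1 := by
  have hceil : ⌈t⌉₊ ≤ ⌈T⌉₊ := Nat.ceil_le_ceil ht
  have hpos : 0 < ⌈T⌉₊ := Nat.ceil_pos.2 (by linarith)
  refine ⟨⟨⌈t⌉₊ - 1, by omega⟩, (min_le_left _ _).trans ?_, ?_⟩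
  · rcases Nat.eq_zero_or_pos ⌈t⌉₊ with hzero | hceil0
    · simpa [hzero] using h0
    · exact (Nat.lt_ceil.1 (Nat.sub_one_lt hceil0.ne')).le
  · have hle : (⌈t⌉₊ : ℝ) ≤ (⌈t⌉₊ - 1 : ℕ) + 1 := by exact_mod_cast (by omega)
    rw [← min_add_add_right, sub_add_cancel]
    exact le_min ((Nat.le_ceil t).trans hle) ht

lemma cube_eq_iUnion {T : ℝ} (hT : 1 ≤ T) :
    cube d T = ⋃ k : Fin d → Fin ⌈T⌉₊, (· - corner T k) ⁻¹' cube d 1 := by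
  ext t
  simp only [Set.mem_iUnion, Set.mem_preimage, mem_cube_iff, Pi.sub_apply, corner, sub_nonneg,
    sub_le_iff_le_add']
  constructor
  · intro h
    choose k hk using fun i => exists_corner_le_le hT (h i).1 (h i).2
    exact ⟨k, hk⟩
  · rintro ⟨k, hk⟩ i
    have hmin : 0 ≤ min ((k i : ℕ) : ℝ) (T - 1) := le_min (by positivity) (by linarith)
    exact ⟨hmin.trans (hk i).1, by linarith [(hk i).2, min_le_right ((k i : ℕ) : ℝ) (T - 1)]⟩

lemma card_corner_le {T : ℝ} (hT : 1 ≤ T) :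
    (Fintype.card (Fin d → Fin ⌈T⌉₊) : ℝ≥0∞) ≤ 2 ^ d * ENNReal.ofReal (T ^ d) := by
  have hceil := Nat.ceil_lt_add_one (by linarith : 0 ≤ T)
  rw [Fintype.card_fun, Fintype.card_fin, Fintype.card_fin, ENNReal.ofReal_pow (by linarith),
    ← mul_pow]
  push_cast
  gcongr
  rw [← ENNReal.ofReal_natCast, ← ENNReal.ofReal_ofNat, ← ENNReal.ofReal_mul (by norm_num)]
  exact ENNReal.ofReal_le_ofReal (by linarith)

end Cubes

section Rate

variable {d : ℕ} {E : Type*}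

/-- The law of a visit to `A` together with its relative position in the cube `[0,T]^d`, which is
uniform and independent of the visit. -/
noncomputable abbrev visitMeasure (d : ℕ) [MeasurableSpace E] (ν : Measure E) (A : Set E) :
    Measure ((Fin d → ℝ) × E) :=
  (volume.restrict (cube d 1)).prod (ν.restrict A)

variable [AddAction (Fin d → ℝ) E] {A : Set E}

lemma exists_visitVolume_corner_mem_Ioc {x : E} {y : ℝ≥0∞} {T : ℝ} (hT : 1 ≤ T)
    (hx : visitVolume A (cube d T) x ∈ Set.Ioc 0 y) :
    ∃ k : Fin d → Fin ⌈T⌉₊, visitVolume A (cube d 1) (corner T k +ᵥ x) ∈ Set.Ioc 0 y := by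
  simp only [visitVolume_vadd]
  rw [cube_eq_iUnion hT] at hx
  obtain ⟨k, -, hk⟩ := Finset.exists_ne_zero_of_sum_ne_zero
    (hx.1.trans_le (visitVolume_iUnion_le A _ x)).ne'
  exact ⟨k, pos_iff_ne_zero.2 hk, (visitVolume_mono A
    (Set.subset_iUnion (fun k => (· - corner T k) ⁻¹' cube d 1) k) x).trans hx.2⟩

/-- The visiting time in `[0,T]^d` of the orbit that is at `x` at the time `T • u`. -/
noncomputable def recentredVolume (A : Set E) (T : ℝ) (p : (Fin d → ℝ) × E) : ℝ≥0∞ :=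
  visitVolume A (cube d T) (-(T • p.1) +ᵥ p.2)

lemma recentredVolume_eq (A : Set E) (T : ℝ) (p : (Fin d → ℝ) × E) :
    recentredVolume A T p = visitVolume A ((· + T • p.1) ⁻¹' cube d T) p.2 := by
  simp only [recentredVolume, visitVolume_vadd, sub_neg_eq_add]

lemma recentredVolume_le (A : Set E) (T : ℝ) (p : (Fin d → ℝ) × E) :
    recentredVolume A T p ≤ visitVolume A (Set.univ : Set (Fin d → ℝ)) p.2 := by
  rw [recentredVolume_eq]
  exact visitVolume_mono A (Set.subset_univ _) _

variable [MeasurableSpace E]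

variable (d) in
/-- The intensity `ν(V > y)` per unit of volume, where `V` is the volume of all visits to `A`: each
visit of an orbit with `V > y` carries the weight `V⁻¹`. For the exponent measure of a max-stable
field this is the Berman function at `y`. -/
noncomputable def visitRate (ν : Measure E) (A : Set E) (y : ℝ≥0∞) : ℝ≥0∞ :=
  ∫⁻ x in A, invAbove y (visitVolume A (Set.univ : Set (Fin d → ℝ)) x) ∂ν

variable {ν : Measure E}

lemma antitone_visitRate : Antitone (visitRate d ν A) := fun _ _ h =>
  lintegral_mono fun _ => antitone_invAbove h _

lemma measure_visitVolume_pos_le [VAddInvariantMeasure (Fin d → ℝ) E ν]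
    (y : ℝ≥0∞) {T : ℝ} (hT : 1 ≤ T) :
    ν {x | 0 < visitVolume A (cube d T) x} ≤ ν {x | y < visitVolume A (cube d T) x} +
      2 ^ d * ENNReal.ofReal (T ^ d) * ν (visitVolume A (cube d 1) ⁻¹' Set.Ioc 0 y) := by
  have hcover : {x | 0 < visitVolume A (cube d T) x} ⊆ {x | y < visitVolume A (cube d T) x} ∪
      ⋃ k : Fin d → Fin ⌈T⌉₊,
        (corner T k +ᵥ ·) ⁻¹' (visitVolume A (cube d 1) ⁻¹' Set.Ioc 0 y) := by
    intro x hx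
    rcases lt_or_ge y (visitVolume A (cube d T) x) with h | h
    · exact .inl h
    · exact .inr (Set.mem_iUnion.2 (exists_visitVolume_corner_mem_Ioc hT ⟨hx, h⟩))
  refine (measure_mono hcover).trans ((measure_union_le _ _).trans ?_)
  gcongr
  refine (measure_iUnion_fintype_le ν _).trans ?_
  simp only [measure_preimage_vadd, Finset.sum_const, nsmul_eq_mul, Finset.card_univ]
  gcongr
  exact card_corner_le hT

lemma tendsto_measure_visitVolume_Ioc [MeasurableVAdd₂ (Fin d → ℝ) E] (hA : MeasurableSet A)
    (hfin : ν {x | 0 < visitVolume A (cube d 1) x} ≠ ∞) :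
    Tendsto (fun n : ℕ => ν (visitVolume A (cube d 1) ⁻¹' Set.Ioc 0 ((n : ℝ≥0∞) + 1)⁻¹))
      atTop (𝓝 0) := by
  have hV := measurable_visitVolume (E := E) hA (measurableSet_cube (d := d) 1)
  have hlevel : Antitone fun n : ℕ => ((n : ℝ≥0∞) + 1)⁻¹ := fun m n h => by
    dsimp only
    gcongr
  have hempty : ⋂ n : ℕ, visitVolume A (cube d 1) ⁻¹' Set.Ioc 0 ((n : ℝ≥0∞) + 1)⁻¹ = ∅ := by
    refine Set.eq_empty_of_forall_notMem fun x hx => ?_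
    have hx : ∀ n : ℕ, visitVolume A (cube d 1) x ∈ Set.Ioc 0 ((n : ℝ≥0∞) + 1)⁻¹ :=
      fun n => Set.mem_iInter.1 hx n
    obtain ⟨n, hn⟩ := ENNReal.exists_inv_nat_lt (hx 0).1.ne'
    exact ((hx n).2.trans (ENNReal.inv_le_inv.2 le_self_add)).not_gt hn
  have hlim := tendsto_measure_iInter_atTop (μ := ν)
    (fun n => (hV measurableSet_Ioc).nullMeasurableSet)
    (fun m n h => Set.preimage_mono (Set.Ioc_subset_Ioc_right (hlevel h)))
    ⟨0, ne_top_of_le_ne_top hfin (measure_mono fun x hx => hx.1)⟩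
  rwa [hempty, measure_empty] at hlim

lemma ae_tendsto_recentredVolume :
    ∀ᵐ p ∂(visitMeasure d ν A), Tendsto (recentredVolume A · p) atTop
      (𝓝 (visitVolume A (Set.univ : Set (Fin d → ℝ)) p.2)) := by
  filter_upwards [Measure.quasiMeasurePreserving_fst.ae ae_cube_interior] with p hp
  simp only [recentredVolume_eq, ← iUnion_cube_sub_smul hp]
  exact tendsto_visitVolume_iUnion A (monotone_cube_sub_smul hp) p.2

variable [SFinite ν] [MeasurableVAdd₂ (Fin d → ℝ) E]

lemma measurable_recentredVolume (hA : MeasurableSet A) (T : ℝ) :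
    Measurable (recentredVolume A T : (Fin d → ℝ) × E → ℝ≥0∞) :=
  (measurable_visitVolume hA (measurableSet_cube T)).comp
    ((measurable_fst.const_smul T).neg.vadd measurable_snd)

lemma lintegral_visitMeasure_snd (hA : MeasurableSet A) (y : ℝ≥0∞) :
    ∫⁻ p, invAbove y (visitVolume A (Set.univ : Set (Fin d → ℝ)) p.2) ∂(visitMeasure d ν A) =
      visitRate d ν A y := by
  have hV := measurable_visitVolume (E := E) hA (MeasurableSet.univ (α := Fin d → ℝ))
  have hF : Measurable fun p : (Fin d → ℝ) × E =>
      invAbove y (visitVolume A (Set.univ : Set (Fin d → ℝ)) p.2) :=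
    (measurable_invAbove y).comp (hV.comp measurable_snd)
  rw [lintegral_prod _ hF.aemeasurable]
  simp [volume_cube_one, visitRate]

variable [VAddInvariantMeasure (Fin d → ℝ) E ν]

lemma measure_lt_visitVolume_cube_div (hA : MeasurableSet A) (y : ℝ≥0∞) {T : ℝ} (hT : 0 < T) :
    ν {x | y < visitVolume A (cube d T) x} / ENNReal.ofReal (T ^ d) =
      ∫⁻ p, invAbove y (recentredVolume A T p) ∂(visitMeasure d ν A) := by
  have hTd : ENNReal.ofReal (T ^ d) ≠ 0 := by simpa using pow_pos hT d
  rw [measure_lt_visitVolume hA (measurableSet_cube T) (volume_cube_ne_top T),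
    lintegral_cube_smul _ hT, mul_comm, ENNReal.mul_div_cancel_right hTd ENNReal.ofReal_ne_top]
  exact (lintegral_prod _
    ((measurable_invAbove y).comp (measurable_recentredVolume hA T)).aemeasurable).symm

lemma tendsto_measure_lt_visitVolume_div (hA : MeasurableSet A) (hfin : ν A ≠ ∞) {y : ℝ≥0∞}
    (hy : y ≠ 0) :
    Tendsto (fun T : ℝ => ν {x | y < visitVolume A (cube d T) x} / ENNReal.ofReal (T ^ d)) atTop
      (𝓝 (visitRate d ν A y)) := by
  have hlim : Tendsto (fun T : ℝ => ∫⁻ p, invAbove y (recentredVolume A T p)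
      ∂(visitMeasure d ν A)) atTop (𝓝 (visitRate d ν A y)) := by
    rw [← lintegral_visitMeasure_snd hA]
    refine tendsto_lintegral_filter_of_dominated_convergence (fun _ => y⁻¹)
      (.of_forall fun T => (measurable_invAbove y).comp (measurable_recentredVolume hA T))
      (.of_forall fun T => .of_forall fun p => invAbove_le_inv _ _) ?_ ?_
    · rw [lintegral_const, ← Set.univ_prod_univ, Measure.prod_prod, Measure.restrict_apply_univ,
        Measure.restrict_apply_univ, volume_cube_one, one_mul]
      exact ENNReal.mul_ne_top (ENNReal.inv_ne_top.2 hy) hfin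
    · filter_upwards [ae_tendsto_recentredVolume] with p hp
      exact tendsto_invAbove_of_le y hp fun T => recentredVolume_le A T p
  refine hlim.congr' ?_
  filter_upwards [eventually_gt_atTop 0] with T hT
  exact (measure_lt_visitVolume_cube_div hA y hT).symm

lemma visitRate_zero_le_liminf (hA : MeasurableSet A) :
    visitRate d ν A 0 ≤ liminf (fun T : ℝ =>
      ν {x | 0 < visitVolume A (cube d T) x} / ENNReal.ofReal (T ^ d)) atTop := by
  calc visitRate d ν A 0
      = ∫⁻ p, liminf (fun T : ℝ => invAbove 0 (recentredVolume A T p)) atTop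
          ∂(visitMeasure d ν A) := by
        rw [← lintegral_visitMeasure_snd hA]
        refine lintegral_congr_ae ?_
        filter_upwards [ae_tendsto_recentredVolume] with p hp
        exact (tendsto_invAbove_of_le 0 hp fun T => recentredVolume_le A T p).liminf_eq.symm
    _ ≤ liminf (fun T : ℝ => ∫⁻ p, invAbove 0 (recentredVolume A T p)
          ∂(visitMeasure d ν A)) atTop :=
        lintegral_liminf_le fun T => (measurable_invAbove 0).comp (measurable_recentredVolume hA T)
    _ = _ := by
        refine liminf_congr ?_
        filter_upwards [eventually_gt_atTop 0] with T hT
        exact (measure_lt_visitVolume_cube_div hA 0 hT).symm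

lemma limsup_le_visitRate_add (hA : MeasurableSet A) (hfin : ν A ≠ ∞) {y : ℝ≥0∞} (hy : y ≠ 0) :
    limsup (fun T : ℝ => ν {x | 0 < visitVolume A (cube d T) x} / ENNReal.ofReal (T ^ d)) atTop ≤
      visitRate d ν A y + 2 ^ d * ν (visitVolume A (cube d 1) ⁻¹' Set.Ioc 0 y) := by
  have hlim := (tendsto_measure_lt_visitVolume_div (d := d) hA hfin hy).add_const
    (2 ^ d * ν (visitVolume A (cube d 1) ⁻¹' Set.Ioc 0 y))
  rw [← hlim.limsup_eq]
  refine limsup_le_limsup ?_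
  filter_upwards [eventually_ge_atTop 1] with T hT
  have hTd : ENNReal.ofReal (T ^ d) ≠ 0 := by simpa using pow_pos (by linarith : 0 < T) d
  refine (ENNReal.div_le_div_right (measure_visitVolume_pos_le y hT) _).trans_eq ?_
  rw [ENNReal.add_div, mul_right_comm, ENNReal.mul_div_cancel_right hTd ENNReal.ofReal_ne_top]

lemma measure_ne_top_of_visitVolume_pos (hA : MeasurableSet A)
    (hfin : ν {x | 0 < visitVolume A (cube d 1) x} ≠ ∞) : ν A ≠ ∞ :=
  ne_top_of_le_ne_top hfin (measure_le_measure_visitVolume_pos hA (measurableSet_cube 1)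
    (by simp [volume_cube_one]) (volume_cube_ne_top 1))

lemma visitRate_ne_top (hA : MeasurableSet A)
    (hfin : ν {x | 0 < visitVolume A (cube d 1) x} ≠ ∞) (y : ℝ≥0∞) : visitRate d ν A y ≠ ∞ := by
  have hAfin : ν A ≠ ∞ := measure_ne_top_of_visitVolume_pos hA hfin
  have hone : visitRate d ν A 1 ≤ ν A := by
    calc visitRate d ν A 1 ≤ ∫⁻ _ in A, 1 ∂ν :=
          lintegral_mono fun x => (invAbove_le_inv _ _).trans_eq inv_one
      _ = ν A := by simp
  have hsmall : ν (visitVolume A (cube d 1) ⁻¹' Set.Ioc 0 1) ≠ ∞ :=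
    ne_top_of_le_ne_top hfin (measure_mono fun x hx => hx.1)
  refine ne_top_of_le_ne_top (ENNReal.add_ne_top.2 ⟨ne_top_of_le_ne_top hAfin hone,
    ENNReal.mul_ne_top (ENNReal.pow_ne_top (a := 2) (n := d) ENNReal.ofNat_ne_top) hsmall⟩) ?_
  exact (antitone_visitRate zero_le).trans ((visitRate_zero_le_liminf hA).trans
    ((liminf_le_limsup).trans (limsup_le_visitRate_add hA hAfin one_ne_zero)))

lemma continuousAt_visitRate (hA : MeasurableSet A)
    (hfin : ν {x | 0 < visitVolume A (cube d 1) x} ≠ ∞) {y : ℝ≥0∞}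
    (hy : ∀ᵐ x ∂(ν.restrict A), visitVolume A (Set.univ : Set (Fin d → ℝ)) x = 0 ∨
      visitVolume A (Set.univ : Set (Fin d → ℝ)) x ≠ y) :
    ContinuousAt (visitRate d ν A) y := by
  refine tendsto_lintegral_filter_of_dominated_convergence
    (fun x => invAbove 0 (visitVolume A (Set.univ : Set (Fin d → ℝ)) x))
    (.of_forall fun z => (measurable_invAbove z).comp (measurable_visitVolume hA .univ))
    (.of_forall fun z => .of_forall fun x => antitone_invAbove (zero_le (a := z)) _)
    (visitRate_ne_top hA hfin 0) ?_
  filter_upwards [hy] with x hx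
  exact continuousAt_invAbove_level hx

theorem tendsto_visitRate (hA : MeasurableSet A)
    (hfin : ν {x | 0 < visitVolume A (cube d 1) x} ≠ ∞) (y : ℝ≥0∞) :
    Tendsto (fun T : ℝ => ν {x | y < visitVolume A (cube d T) x} / ENNReal.ofReal (T ^ d)) atTop
      (𝓝 (visitRate d ν A y)) := by
  have hAfin : ν A ≠ ∞ := measure_ne_top_of_visitVolume_pos hA hfin
  rcases ne_or_eq y 0 with hy | rfl
  · exact tendsto_measure_lt_visitVolume_div hA hAfin hy
  refine tendsto_of_le_liminf_of_limsup_le (visitRate_zero_le_liminf hA) ?_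
  have hlim : Tendsto (fun n : ℕ => visitRate d ν A 0 +
      2 ^ d * ν (visitVolume A (cube d 1) ⁻¹' Set.Ioc 0 ((n : ℝ≥0∞) + 1)⁻¹)) atTop
      (𝓝 (visitRate d ν A 0)) := by
    simpa using (ENNReal.Tendsto.const_mul (tendsto_measure_visitVolume_Ioc hA hfin)
      (.inr (ENNReal.pow_ne_top (n := d) ENNReal.ofNat_ne_top))).const_add (visitRate d ν A 0)
  refine ge_of_tendsto' hlim fun n => ?_
  refine (limsup_le_visitRate_add hA hAfin (y := ((n : ℝ≥0∞) + 1)⁻¹) (by simp)).trans ?_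
  gcongr
  exact antitone_visitRate zero_le

end Rate

section Paths

lemma measurable_of_measurableSet_pos_lt {α : Type*} [MeasurableSpace α] {g : α → ℝ≥0}
    (hg : ∀ x, 0 < x → MeasurableSet {a | x < g a}) : Measurable g := by
  refine measurable_of_Ioi fun x => ?_
  rcases eq_zero_or_pos x with rfl | hx
  · have hunion : g ⁻¹' Set.Ioi 0 = ⋃ n : ℕ, {a | 1 / ((n : ℝ≥0) + 1) < g a} := by
      ext a
      simp only [Set.mem_preimage, Set.mem_Ioi, Set.mem_iUnion, Set.mem_ofPred_eq]
      exact ⟨exists_nat_one_div_lt, fun ⟨n, hn⟩ => pos_of_gt hn⟩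
    rw [hunion]
    exact MeasurableSet.iUnion fun n => hg _ (by positivity)
  · exact hg x hx

variable {d : ℕ}

/-- The space of non-negative continuous paths on `ℝ^d`. It carries the σ-algebra generated by the
evaluations, and `ℝ^d` acts on it by translation. -/
abbrev ContPath (d : ℕ) : Type := C(Fin d → ℝ, ℝ≥0)

namespace ContPath

instance instMeasurableSpace : MeasurableSpace (ContPath d) :=
  .comap (fun f t => f t) MeasurableSpace.pi

@[fun_prop]
lemma measurable_eval (t : Fin d → ℝ) : Measurable fun f : ContPath d => f t :=
  (measurable_pi_apply t).comp (comap_measurable _)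

lemma measurable_of_eval {α : Type*} [MeasurableSpace α] {W : α → ContPath d}
    (hW : ∀ t, Measurable fun a => W a t) : Measurable W :=
  measurable_comap_iff.2 (measurable_pi_lambda _ hW)

lemma measurable_uncurry_eval : Measurable fun p : (Fin d → ℝ) × ContPath d => p.2 p.1 :=
  measurable_uncurry_of_continuous_of_measurable (u := fun (t : Fin d → ℝ) (f : ContPath d) => f t)
    (fun f => f.continuous) measurable_eval

instance instAddAction : AddAction (Fin d → ℝ) (ContPath d) where
  vadd h f := ⟨fun t => f (t + h), by fun_prop⟩
  zero_vadd f := by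
    ext t
    exact congrArg (fun s => (f s : ℝ)) (add_zero t)
  add_vadd g h f := by
    ext t
    exact congrArg (fun s => (f s : ℝ)) (add_assoc t g h).symm

@[simp]
lemma vadd_apply (h : Fin d → ℝ) (f : ContPath d) (t : Fin d → ℝ) : (h +ᵥ f) t = f (t + h) := rfl

lemma vadd_eq_zero_iff (h : Fin d → ℝ) (f : ContPath d) : h +ᵥ f = 0 ↔ f = 0 :=
  vadd_left_cancel_iff (y := (0 : ContPath d)) h

instance instMeasurableVAdd₂ : MeasurableVAdd₂ (Fin d → ℝ) (ContPath d) where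
  measurable_vadd := measurable_of_eval fun t =>
    measurable_uncurry_eval.comp ((measurable_fst.const_add t).prodMk measurable_snd)

/-- The set of paths that exceed, at one of the sites `t j`, the level `x j`. -/
def exceedSet {ι : Type*} (t : ι → Fin d → ℝ) (x : ι → ℝ≥0) : Set (ContPath d) :=
  {f | ∃ j, x j < f (t j)}

lemma measurableSet_lt_eval (t : Fin d → ℝ) (x : ℝ≥0) :
    MeasurableSet {f : ContPath d | x < f t} :=
  measurableSet_lt measurable_const (measurable_eval t)

lemma measurableSet_exceedSet {ι : Type*} [Finite ι] (t : ι → Fin d → ℝ) (x : ι → ℝ≥0) :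
    MeasurableSet (exceedSet t x) := by
  rw [exceedSet, Set.ofPred_exists]
  exact MeasurableSet.iUnion fun j => measurableSet_lt_eval (t j) (x j)

lemma exceedSet_const (t : Fin d → ℝ) (x : ℝ≥0) :
    exceedSet (fun _ : Unit => t) (fun _ => x) = {f | x < f t} := by
  simp [exceedSet]

lemma exceedSet_sumElim {ι κ : Type*} (t : ι → Fin d → ℝ) (s : κ → Fin d → ℝ) (x : ι → ℝ≥0)
    (y : κ → ℝ≥0) :
    exceedSet (Sum.elim t s) (Sum.elim x y) = exceedSet t x ∪ exceedSet s y := by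
  ext f
  simp [exceedSet]

lemma preimage_vadd_exceedSet {ι : Type*} (t : ι → Fin d → ℝ) (x : ι → ℝ≥0) (h : Fin d → ℝ) :
    (h +ᵥ ·) ⁻¹' exceedSet t x = exceedSet (fun j => t j + h) x := rfl

/-- The sets of paths that stay below finitely many positive levels at finitely many sites. -/
def lowerSets (d : ℕ) : Set (Set (ContPath d)) :=
  {A | ∃ (ι : Type) (_ : Finite ι) (t : ι → Fin d → ℝ) (x : ι → ℝ≥0),
    (∀ j, 0 < x j) ∧ A = (exceedSet t x)ᶜ}

lemma isPiSystem_lowerSets : IsPiSystem (lowerSets d) := by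
  rintro _ ⟨ι, _, t, x, hx, rfl⟩ _ ⟨κ, _, s, y, hy, rfl⟩ -
  refine ⟨ι ⊕ κ, inferInstance, Sum.elim t s, Sum.elim x y, ?_, ?_⟩
  · rintro (j | j)
    exacts [hx j, hy j]
  · rw [exceedSet_sumElim, Set.compl_union]

lemma generateFrom_lowerSets :
    (instMeasurableSpace : MeasurableSpace (ContPath d)) =
      MeasurableSpace.generateFrom (lowerSets d) := by
  refine le_antisymm ?_ (MeasurableSpace.generateFrom_le ?_)
  · have hlt : ∀ (t : Fin d → ℝ) (x : ℝ≥0), 0 < x →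
        MeasurableSet[MeasurableSpace.generateFrom (lowerSets d)] {f : ContPath d | x < f t} := by
      intro t x hx
      rw [← exceedSet_const]
      exact MeasurableSet.of_compl (MeasurableSpace.measurableSet_generateFrom
        ⟨Unit, inferInstance, _, _, fun _ => hx, rfl⟩)
    have heval : Measurable[MeasurableSpace.generateFrom (lowerSets d)]
        fun (f : ContPath d) t => f t :=
      @measurable_pi_lambda _ _ _ (_) _ _ fun t =>
        @measurable_of_measurableSet_pos_lt _ (_) _ (hlt t)
    exact heval.comap_le
  · rintro _ ⟨ι, _, t, x, -, rfl⟩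
    exact (measurableSet_exceedSet t x).compl

lemma compl_zero_eq_iUnion : ({0}ᶜ : Set (ContPath d)) = ⋃ p : ℕ × ℕ,
    {f | 1 / ((p.1 : ℝ≥0) + 1) < f (TopologicalSpace.denseSeq (Fin d → ℝ) p.2)} := by
  ext f
  simp only [Set.mem_compl_iff, Set.mem_singleton_iff, Set.mem_iUnion, Set.mem_ofPred_eq]
  constructor
  · intro hf
    obtain ⟨t, ht⟩ := DFunLike.ne_iff.1 hf
    obtain ⟨m, hm⟩ := (TopologicalSpace.denseRange_denseSeq (Fin d → ℝ)).exists_mem_open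
      (isOpen_lt continuous_const f.continuous) ⟨t, pos_iff_ne_zero.2 ht⟩
    obtain ⟨n, hn⟩ := exists_nat_one_div_lt (show 0 < f _ from hm)
    exact ⟨(n, m), hn⟩
  · rintro ⟨p, hp⟩ rfl
    exact not_lt_zero hp

lemma measurableSet_zero : MeasurableSet ({0} : Set (ContPath d)) := by
  refine MeasurableSet.of_compl ?_
  rw [compl_zero_eq_iUnion]
  exact MeasurableSet.iUnion fun p => measurableSet_lt_eval _ _

section Measure

variable {μ ν : Measure (ContPath d)}

lemma measure_exceedSet_ne_top (hfin : ∀ t x, 0 < x → μ {f | x < f t} ≠ ∞) {ι : Type*} [Finite ι]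
    (t : ι → Fin d → ℝ) {x : ι → ℝ≥0} (hx : ∀ j, 0 < x j) : μ (exceedSet t x) ≠ ∞ := by
  have := Fintype.ofFinite ι
  rw [exceedSet, Set.ofPred_exists]
  refine ((measure_iUnion_fintype_le μ _).trans_lt ?_).ne
  exact ENNReal.sum_lt_top.2 fun j _ => (hfin _ _ (hx j)).lt_top

lemma measure_compl_exceedSet_inter (hfin : ∀ t x, 0 < x → μ {f | x < f t} ≠ ∞) {ι : Type*}
    [Finite ι] (t : ι → Fin d → ℝ) {x : ι → ℝ≥0} (hx : ∀ j, 0 < x j) (s : Fin d → ℝ) (y : ℝ≥0) :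
    μ ((exceedSet t x)ᶜ ∩ {f | y < f s}) =
      μ (exceedSet (Sum.elim t fun _ : Unit => s) (Sum.elim x fun _ => y)) -
        μ (exceedSet t x) := by
  rw [exceedSet_sumElim, exceedSet_const, ← measure_sdiff Set.subset_union_left
    (measurableSet_exceedSet t x).nullMeasurableSet (measure_exceedSet_ne_top hfin t hx),
    Set.union_sdiff_left, Set.inter_comm, Set.sdiff_eq]

lemma restrict_lt_eval_ext (hfin : ∀ t x, 0 < x → μ {f | x < f t} ≠ ∞)
    (h : ∀ {ι : Type} [Finite ι] (t : ι → Fin d → ℝ) (x : ι → ℝ≥0), (∀ j, 0 < x j) →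
      μ (exceedSet t x) = ν (exceedSet t x)) (s : Fin d → ℝ) {y : ℝ≥0} (hy : 0 < y) :
    μ.restrict {f | y < f s} = ν.restrict {f | y < f s} := by
  have hlt : ∀ (t : Fin d → ℝ) (x : ℝ≥0), 0 < x → μ {f | x < f t} = ν {f | x < f t} := by
    intro t x hx
    rw [← exceedSet_const]
    exact h _ _ fun _ => hx
  have hfinν : ∀ t x, 0 < x → ν {f | x < f t} ≠ ∞ := fun t x hx => hlt t x hx ▸ hfin t x hx
  have : IsFiniteMeasure (μ.restrict {f | y < f s}) := ⟨by simpa using (hfin s y hy).lt_top⟩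
  refine ext_of_generate_finite _ generateFrom_lowerSets isPiSystem_lowerSets ?_
    (by simpa using hlt s y hy)
  rintro _ ⟨ι, _, t, x, hx, rfl⟩
  have hm := (measurableSet_exceedSet t x).compl
  rw [Measure.restrict_apply hm, Measure.restrict_apply hm,
    measure_compl_exceedSet_inter hfin t hx, measure_compl_exceedSet_inter hfinν t hx, h t x hx,
    h _ _ (by rintro (j | _); exacts [hx j, hy])]

theorem measure_ext (hzero : μ {0} = ν {0}) (hfin : ∀ t x, 0 < x → μ {f | x < f t} ≠ ∞)
    (h : ∀ {ι : Type} [Finite ι] (t : ι → Fin d → ℝ) (x : ι → ℝ≥0), (∀ j, 0 < x j) →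
      μ (exceedSet t x) = ν (exceedSet t x)) : μ = ν := by
  have hcompl : μ.restrict {0}ᶜ = ν.restrict {0}ᶜ := by
    rw [compl_zero_eq_iUnion, Measure.restrict_iUnion_congr]
    exact fun p => restrict_lt_eval_ext hfin h _ (by positivity)
  rw [← Measure.restrict_add_restrict_compl (μ := μ) measurableSet_zero,
    ← Measure.restrict_add_restrict_compl (μ := ν) measurableSet_zero, hcompl,
    Measure.restrict_singleton, Measure.restrict_singleton, hzero]

theorem vaddInvariantMeasure_of_exceedSet (hfin : ∀ t x, 0 < x → μ {f | x < f t} ≠ ∞)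
    (hshift : ∀ {ι : Type} [Finite ι] (t : ι → Fin d → ℝ) (x : ι → ℝ≥0), (∀ j, 0 < x j) →
      ∀ h, μ (exceedSet (fun j => t j + h) x) = μ (exceedSet t x)) :
    VAddInvariantMeasure (Fin d → ℝ) (ContPath d) μ where
  measure_preimage_vadd h s hs := by
    have hmap : μ = μ.map (h +ᵥ ·) := by
      refine measure_ext ?_ hfin fun t x hx => ?_
      · have hpre : (h +ᵥ ·) ⁻¹' {0} = ({0} : Set (ContPath d)) := by
          ext f
          exact vadd_eq_zero_iff h f
        rw [Measure.map_apply (measurable_const_vadd h) measurableSet_zero, hpre]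
      · rw [Measure.map_apply (measurable_const_vadd h) (measurableSet_exceedSet t x),
          preimage_vadd_exceedSet, hshift t x hx]
    rw [← Measure.map_apply (measurable_const_vadd h) hs, ← hmap]

end Measure

end ContPath

end Paths

section LevelSets

/-- If two distinct levels below `g a` had superlevel sets of the same finite measure, the open set
between them would be null, hence empty, against the intermediate value theorem. -/
lemma subsingleton_setOf_measure_lt_eq {X R : Type*} [TopologicalSpace X] [PreconnectedSpace X]
    [MeasurableSpace X] [OpensMeasurableSpace X] {μ : Measure X} [μ.IsOpenPosMeasure]
    (hμ : μ Set.univ = ∞) [LinearOrder R] [DenselyOrdered R] [TopologicalSpace R]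
    [OrderClosedTopology R] {g : X → R} (hg : Continuous g) (a : X) {y : ℝ≥0∞} (hy : y ≠ ∞) :
    {s | s < g a ∧ μ {t | s < g t} = y}.Subsingleton := by
  have not_lt_of_eq : ∀ r s, s < g a → μ {t | r < g t} = y → μ {t | s < g t} = y → ¬ r < s := by
    intro r s hsa hr hs hrs
    have hnull : μ ({t | r < g t} \ {t | s < g t}) = 0 := by
      have hsub : {t | s < g t} ⊆ {t | r < g t} := fun t (ht : s < g t) => hrs.trans ht
      rw [measure_sdiff hsub (isOpen_lt continuous_const hg).measurableSet.nullMeasurableSet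
        (by rwa [hs]), hr, hs, tsub_self]
    have hopen : IsOpen {t | r < g t ∧ g t < s} :=
      (isOpen_lt continuous_const hg).inter (isOpen_lt hg continuous_const)
    have hsub : {t | r < g t ∧ g t < s} ⊆ {t | r < g t} \ {t | s < g t} :=
      fun t ht => ⟨ht.1, not_lt.2 ht.2.le⟩
    have hempty : {t | r < g t ∧ g t < s} = ∅ :=
      (hopen.measure_eq_zero_iff μ).1 (measure_mono_null hsub hnull)
    obtain ⟨c, hrc, hcs⟩ := exists_between hrs
    have hbelow : ∃ t, g t ≤ r := by
      by_contra! hall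
      have huniv : {t | r < g t} = Set.univ := Set.eq_univ_of_forall hall
      exact hy (by rw [← hr, huniv, hμ])
    obtain ⟨t, ht⟩ := hbelow
    obtain ⟨b, rfl⟩ := mem_range_of_exists_le_of_exists_ge hg ⟨t, ht.trans hrc.le⟩
      ⟨a, (hcs.trans hsa).le⟩
    exact Set.eq_empty_iff_forall_notMem.1 hempty b ⟨hrc, hcs⟩
  rintro r ⟨hra, hr⟩ s ⟨hsa, hs⟩
  exact le_antisymm (not_lt.1 (not_lt_of_eq s r hra hs hr)) (not_lt.1 (not_lt_of_eq r s hsa hr hs))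

end LevelSets

section ExponentMeasure

namespace ContPath

variable {d : ℕ}

/-- The path `f / s`, meaningful for `s > 0` only. -/
noncomputable def scale (s : ℝ) (f : ContPath d) : ContPath d := s.toNNReal⁻¹ • f

lemma lt_scale_iff {s : ℝ} (hs : 0 < s) {f : ContPath d} {t : Fin d → ℝ} {x : ℝ≥0} :
    x < scale s f t ↔ s * x < f t := by
  rw [scale, ContinuousMap.smul_apply, smul_eq_mul, lt_inv_mul_iff₀ (Real.toNNReal_pos.2 hs),
    ← NNReal.coe_lt_coe, NNReal.coe_mul, Real.coe_toNNReal s hs.le]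

lemma lt_scale_iff_of_eq_toNNReal {s : ℝ} (hs : 0 < s) {f : ContPath d} {t : Fin d → ℝ} {x : ℝ≥0}
    {z : ℝ} (hz : f t = z.toNNReal) : x < scale s f t ↔ s * x < z := by
  have hnonneg : 0 ≤ s * x := by positivity
  rw [lt_scale_iff hs, hz, Real.coe_toNNReal', lt_max_iff, or_iff_left hnonneg.not_gt]

lemma measurable_scale_prod {Ω : Type*} [MeasurableSpace Ω] {W : Ω → ContPath d}
    (hW : Measurable W) : Measurable fun p : Ω × ℝ => scale p.2 (W p.1) :=
  measurable_of_eval fun t => (measurable_real_toNNReal.comp measurable_snd).inv.mul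
    ((measurable_eval t).comp (hW.comp measurable_fst))

variable (d) in
/-- The set of paths that exceed `1` at the origin. A path translated by `t` belongs to it if and
only if the path exceeds `1` at `t`, so that sojourn times above `1` are visit volumes. -/
def exceedOrigin : Set (ContPath d) := {f | 1 < f 0}

lemma measurableSet_exceedOrigin : MeasurableSet (exceedOrigin d) := measurableSet_lt_eval 0 1

lemma visitVolume_exceedOrigin (Q : Set (Fin d → ℝ)) (f : ContPath d) :
    visitVolume (exceedOrigin d) Q f = volume {t ∈ Q | 1 < f t} := by
  simp [visitVolume, exceedOrigin]

end ContPath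

open ContPath

variable {Ω : Type*} [MeasurableSpace Ω] {P : Measure Ω} {d : ℕ} {Z : (Fin d → ℝ) → Ω → ℝ}

lemma exists_measurable_contPath (hmeas : ∀ t, Measurable (Z t))
    (hcont : ∀ᵐ ω ∂P, Continuous fun t => Z t ω) :
    ∃ W : Ω → ContPath d, Measurable W ∧ ∀ᵐ ω ∂P, ∀ t, W ω t = (Z t ω).toNNReal := by
  classical
  let N := toMeasurable P {ω | ¬ Continuous fun t => Z t ω}
  have hN : P N = 0 := by
    rw [measure_toMeasurable]
    exact ae_iff.1 hcont
  have hgood : ∀ ω, ω ∉ N → Continuous fun t => Z t ω := fun ω hω =>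
    not_not.1 fun h => hω (subset_toMeasurable P _ h)
  refine ⟨fun ω => ⟨fun t => if ω ∈ N then 0 else (Z t ω).toNNReal, ?_⟩, ?_, ?_⟩
  · split_ifs with h
    exacts [continuous_const, continuous_real_toNNReal.comp (hgood ω h)]
  · exact measurable_of_eval fun t => Measurable.ite (measurableSet_toMeasurable _ _)
      measurable_const (hmeas t).real_toNNReal
  · filter_upwards [measure_eq_zero_iff_ae_notMem.1 hN] with ω hω t
    simp [hω]

/-- The exponent measure of the max-stable field with spectral field `W`: the image of `P ⊗ ds` on
`Ω × (0, ∞)` under `(ω, s) ↦ W ω / s`. -/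
noncomputable def exponentMeasure (P : Measure Ω) (W : Ω → ContPath d) : Measure (ContPath d) :=
  (P.prod (volume.restrict (Set.Ioi 0))).map fun p => scale p.2 (W p.1)

instance instSFiniteExponentMeasure [SFinite P] (W : Ω → ContPath d) :
    SFinite (exponentMeasure P W) := by
  unfold exponentMeasure
  infer_instance

variable {W : Ω → ContPath d}

lemma exponentMeasure_apply [SFinite P] (hW : Measurable W) {A : Set (ContPath d)}
    (hA : MeasurableSet A) :
    exponentMeasure P W A = ∫⁻ s in Set.Ioi 0, P {ω | scale s (W ω) ∈ A} := by
  rw [exponentMeasure, Measure.map_apply (measurable_scale_prod hW) hA,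
    Measure.prod_apply_symm (measurable_scale_prod hW hA)]
  rfl

lemma exponentMeasure_apply_symm (hW : Measurable W) {A : Set (ContPath d)}
    (hA : MeasurableSet A) :
    exponentMeasure P W A = ∫⁻ ω, volume {s | scale s (W ω) ∈ A ∧ 0 < s} ∂P := by
  rw [exponentMeasure, Measure.map_apply (measurable_scale_prod hW) hA,
    Measure.prod_apply (measurable_scale_prod hW hA)]
  refine lintegral_congr fun ω => ?_
  exact Measure.restrict_apply (measurable_prodMk_left (measurable_scale_prod hW hA))

lemma exponentMeasure_exceedSet [SFinite P] (hW : Measurable W)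
    (hWZ : ∀ᵐ ω ∂P, ∀ t, W ω t = (Z t ω).toNNReal) {ι : Type*} [Finite ι] (t : ι → Fin d → ℝ)
    (x : ι → ℝ≥0) :
    exponentMeasure P W (exceedSet t x) =
      ∫⁻ r in Set.Ioi 0, exceedProb P Z t (fun j => (x j : ℝ)) r := by
  rw [exponentMeasure_apply hW (measurableSet_exceedSet t x)]
  refine setLIntegral_congr_fun measurableSet_Ioi fun s hs => measure_congr ?_
  filter_upwards [hWZ] with ω hω
  exact propext (exists_congr fun j => lt_scale_iff_of_eq_toNNReal hs (hω (t j)))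

lemma bermanOnCube_eq_exponentMeasure [SFinite P] (hW : Measurable W)
    (hWZ : ∀ᵐ ω ∂P, ∀ t, W ω t = (Z t ω).toNNReal) (T x : ℝ) :
    bermanOnCube P Z T x =
      exponentMeasure P W {f | ENNReal.ofReal x < visitVolume (exceedOrigin d) (cube d T) f} := by
  rw [exponentMeasure_apply hW (measurableSet_lt measurable_const
    (measurable_visitVolume measurableSet_exceedOrigin (measurableSet_cube T)))]
  refine setLIntegral_congr_fun measurableSet_Ioi fun s hs => measure_congr ?_
  filter_upwards [hWZ] with ω hω
  have hsojourn : sojourn Z T s ω = visitVolume (exceedOrigin d) (cube d T) (scale s (W ω)) := by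
    simp_rw [visitVolume_exceedOrigin, lt_scale_iff_of_eq_toNNReal hs (hω _), NNReal.coe_one,
      mul_one]
    rfl
  exact congrArg (ENNReal.ofReal x < ·) hsojourn

lemma volume_ofReal_le (c : ℝ≥0∞) : volume {s : ℝ | ENNReal.ofReal s ≤ c ∧ 0 < s} ≤ c := by
  rcases eq_or_ne c ∞ with rfl | hc
  · exact le_top
  · calc volume {s : ℝ | ENNReal.ofReal s ≤ c ∧ 0 < s}
        ≤ volume (Set.Ioc 0 c.toReal) :=
          measure_mono fun s hs => ⟨hs.2, (ENNReal.ofReal_le_iff_le_toReal hc).1 hs.1⟩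
      _ = c := by simp [hc]

lemma exponentMeasure_le (hW : Measurable W) {A : Set (ContPath d)} (hA : MeasurableSet A)
    {Q : Set (Fin d → ℝ)} {x : ℝ≥0} (hx : 0 < x) (hAQ : ∀ f ∈ A, ∃ t ∈ Q, x < f t) :
    exponentMeasure P W A ≤ (∫⁻ ω, ⨆ t ∈ Q, (W ω t : ℝ≥0∞) ∂P) / x := by
  have hx0 : (x : ℝ≥0∞) ≠ 0 := by exact_mod_cast hx.ne'
  rw [exponentMeasure_apply_symm hW hA, ENNReal.div_eq_inv_mul,
    ← lintegral_const_mul' _ _ (ENNReal.inv_ne_top.2 hx0)]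
  refine lintegral_mono fun ω => (measure_mono ?_).trans (volume_ofReal_le _)
  rintro s ⟨hsA, hs⟩
  obtain ⟨t, htQ, ht⟩ := hAQ _ hsA
  refine ⟨?_, hs⟩
  rw [← ENNReal.div_eq_inv_mul, ENNReal.le_div_iff_mul_le (.inl hx0) (.inl ENNReal.coe_ne_top)]
  calc ENNReal.ofReal s * x = ENNReal.ofReal (s * x) := by
        rw [ENNReal.ofReal_mul hs.le, ENNReal.ofReal_coe_nnreal]
    _ ≤ ENNReal.ofReal (W ω t) := ENNReal.ofReal_le_ofReal ((lt_scale_iff hs).1 ht).le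
    _ = W ω t := ENNReal.ofReal_coe_nnreal
    _ ≤ ⨆ t ∈ Q, (W ω t : ℝ≥0∞) := le_iSup₂ (f := fun t (_ : t ∈ Q) => (W ω t : ℝ≥0∞)) t htQ

lemma exponentMeasure_visitVolume_pos_ne_top (hW : Measurable W) {T : ℝ}
    (hsup : ∫⁻ ω, ⨆ t ∈ cube d T, (W ω t : ℝ≥0∞) ∂P ≠ ∞) :
    exponentMeasure P W {f | 0 < visitVolume (exceedOrigin d) (cube d T) f} ≠ ∞ := by
  refine ne_top_of_le_ne_top (ENNReal.div_ne_top hsup (by simp))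
    (exponentMeasure_le hW (measurableSet_lt measurable_const (measurable_visitVolume
      measurableSet_exceedOrigin (measurableSet_cube T))) one_pos fun f hf => ?_)
  rw [Set.mem_ofPred_eq, visitVolume_exceedOrigin] at hf
  exact nonempty_of_measure_ne_zero hf.ne'

theorem vaddInvariantMeasure_exponentMeasure [IsProbabilityMeasure P] (hW : Measurable W)
    (hWZ : ∀ᵐ ω ∂P, ∀ t, W ω t = (Z t ω).toNNReal) (hmeas : ∀ t, Measurable (Z t))
    {Q : Set (Fin d → ℝ)} (hQ : Q.Nonempty) (hsup : ∫⁻ ω, ⨆ t ∈ Q, (W ω t : ℝ≥0∞) ∂P ≠ ∞)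
    (hstat : IsStationaryField (deHaanMeasure P) (maxStableField Z)) :
    VAddInvariantMeasure (Fin d → ℝ) (ContPath d) (exponentMeasure P W) := by
  have hshift : ∀ {ι : Type} [Finite ι] (t : ι → Fin d → ℝ) (x : ι → ℝ≥0), (∀ j, 0 < x j) →
      ∀ h, exponentMeasure P W (exceedSet (fun j => t j + h) x) =
        exponentMeasure P W (exceedSet t x) := by
    intro ι _ t x hx h
    rw [exponentMeasure_exceedSet hW hWZ, exponentMeasure_exceedSet hW hWZ,
      lintegral_exceedProb_shift P hmeas hstat t (by exact_mod_cast hx) h]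
  refine vaddInvariantMeasure_of_exceedSet (fun t x hx => ?_) hshift
  obtain ⟨t₀, ht₀⟩ := hQ
  have hmove : exponentMeasure P W {f | x < f t} = exponentMeasure P W {f | x < f t₀} := by
    simpa only [exceedSet_const, add_sub_cancel]
      using hshift (fun _ : Unit => t₀) (fun _ => x) (fun _ => hx) (t - t₀)
  rw [hmove]
  exact ne_top_of_le_ne_top (ENNReal.div_ne_top hsup (by simpa using hx.ne'))
    (exponentMeasure_le hW (measurableSet_lt_eval t₀ x) hx fun f hf => ⟨t₀, ht₀, hf⟩)

lemma ae_visitVolume_univ_ne (hd : 1 ≤ d) (hW : Measurable W) {y : ℝ≥0∞} (hy : y ≠ ∞) :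
    ∀ᵐ f ∂((exponentMeasure P W).restrict (exceedOrigin d)),
      visitVolume (exceedOrigin d) (Set.univ : Set (Fin d → ℝ)) f ≠ y := by
  have : Nonempty (Fin d) := ⟨⟨0, hd⟩⟩
  have : NoncompactSpace (Fin d → ℝ) := NormedSpace.noncompactSpace ℝ _
  have hlevel : MeasurableSet {f : ContPath d |
      visitVolume (exceedOrigin d) (Set.univ : Set (Fin d → ℝ)) f = y} :=
    measurable_visitVolume measurableSet_exceedOrigin .univ (measurableSet_singleton y)
  rw [ae_iff]
  simp only [ne_eq, not_not]
  rw [Measure.restrict_apply hlevel,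
    exponentMeasure_apply_symm hW (hlevel.inter measurableSet_exceedOrigin)]
  refine (lintegral_congr fun ω => Set.Subsingleton.measure_zero ?_ _).trans lintegral_zero
  refine (subsingleton_setOf_measure_lt_eq (measure_univ_of_isAddLeftInvariant volume)
    (g := fun t => (W ω t : ℝ)) (by fun_prop) 0 hy).anti ?_
  rintro s ⟨⟨hvol, horigin⟩, hs⟩
  have hone : ∀ t, 1 < scale s (W ω) t ↔ s < W ω t := fun t => by simp [lt_scale_iff hs]
  rw [Set.mem_ofPred_eq, visitVolume_exceedOrigin] at hvol
  simp only [Set.mem_univ, true_and, hone] at hvol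
  exact ⟨(hone 0).1 horigin, hvol⟩

end ExponentMeasure

end Berman

theorem mainTheorem9_general {Ω : Type*} [MeasurableSpace Ω] (P : Measure Ω)
    [IsProbabilityMeasure P] {d : ℕ} (hd : 1 ≤ d) (Z : (Fin d → ℝ) → Ω → ℝ)
    (hmeas : ∀ t, Measurable (Z t))
    (hsup : ∫⁻ ω, ⨆ t ∈ Berman.cube d 1, ENNReal.ofReal (Z t ω) ∂P < ∞)
    (hstat : Berman.IsStationaryField (Berman.deHaanMeasure P) (Berman.maxStableField Z))
    (hcont : ∀ᵐ ω ∂P, Continuous (fun t => Z t ω)) :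
    (∀ x : ℝ, 0 ≤ x →
      Tendsto (fun T : ℝ => Berman.bermanOnCube P Z T x / ENNReal.ofReal (T ^ d)) atTop
        (𝓝 (Berman.bermanFunction P Z x)) ∧
      Berman.bermanFunction P Z x < ∞) ∧
    ContinuousOn (Berman.bermanFunction P Z) (Set.Ici 0) := by
  obtain ⟨W, hW, hWZ⟩ := Berman.exists_measurable_contPath hmeas hcont
  have hsupW : ∫⁻ ω, ⨆ t ∈ Berman.cube d 1, (W ω t : ℝ≥0∞) ∂P ≠ ∞ := by
    refine ne_of_eq_of_ne (lintegral_congr_ae ?_) hsup.ne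
    filter_upwards [hWZ] with ω hω
    simp_rw [hω, ENNReal.ofReal]
  set ν := Berman.exponentMeasure P W
  have hinv := Berman.vaddInvariantMeasure_exponentMeasure hW hWZ hmeas
    (Set.nonempty_Icc.2 fun _ => zero_le_one) hsupW hstat
  have hA := Berman.ContPath.measurableSet_exceedOrigin (d := d)
  have hfin := Berman.exponentMeasure_visitVolume_pos_ne_top hW hsupW
  have hlim : ∀ x : ℝ,
      Tendsto (fun T : ℝ => Berman.bermanOnCube P Z T x / ENNReal.ofReal (T ^ d)) atTop
        (𝓝 (Berman.visitRate d ν (Berman.ContPath.exceedOrigin d) (ENNReal.ofReal x))) := by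
    intro x
    simp_rw [Berman.bermanOnCube_eq_exponentMeasure hW hWZ]
    exact Berman.tendsto_visitRate hA hfin _
  have hrate : Berman.bermanFunction P Z = _ := funext fun x => (hlim x).limUnder_eq
  rw [hrate]
  refine ⟨fun x _ => ⟨hlim x, (Berman.visitRate_ne_top hA hfin _).lt_top⟩,
    (continuous_iff_continuousAt.2 fun x => ?_).continuousOn⟩
  have hne := Berman.ae_visitVolume_univ_ne (P := P) hd hW (ENNReal.ofReal_ne_top (r := x))
  exact (Berman.continuousAt_visitRate hA hfin (hne.mono fun _ => .inr)).comp
    (f := ENNReal.ofReal) ENNReal.continuous_ofReal.continuousAt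

theorem mainTheorem9 {Ω : Type*} [MeasurableSpace Ω] (P : Measure Ω) [IsProbabilityMeasure P]
    {d : ℕ} (hd : 1 ≤ d) (Z : (Fin d → ℝ) → Ω → ℝ)
    (hmeas : ∀ t, Measurable (Z t))
    (hnonneg : ∀ᵐ ω ∂P, ∀ t, 0 ≤ Z t ω)
    (hmean : ∀ t, ∫ ω, Z t ω ∂P = 1)
    (hsup : ∀ T : ℝ, 0 < T → ∫⁻ ω, ⨆ t ∈ Berman.cube d T, ENNReal.ofReal (Z t ω) ∂P < ∞)
    (hstat : Berman.IsStationaryField (Berman.deHaanMeasure P) (Berman.maxStableField Z))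
    (hcont : ∀ᵐ ω ∂P, Continuous (fun t => Z t ω)) :
    (∀ x : ℝ, 0 ≤ x →
      Tendsto (fun T : ℝ => Berman.bermanOnCube P Z T x / ENNReal.ofReal (T ^ d)) atTop
        (𝓝 (Berman.bermanFunction P Z x)) ∧
      Berman.bermanFunction P Z x < ∞) ∧
    ContinuousOn (Berman.bermanFunction P Z) (Set.Ici 0) :=
  mainTheorem9_general P hd Z hmeas (hsup 1 one_pos) hstat hcont
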